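/- Let $m \ge 3$, let $D \subset \mathbb{R}^m$ be a bounded Lipschitz domain, let $\mu \in \mathbb{R}\setminus\{0\}$ and $\alpha \in (0,1)$, and let $$(Tu)(x) = \int_D E_m(x-y)\,u(y)\,\mathrm{d}y, \qquad E_m(x) = \frac{1}{(2-m)\,\omega_m\,|x|^{m-2}}, \qquad \omega_m = \frac{2\pi^{m/2}}{\Gamma(m/2)},$$ be the Newtonian potential operator on $L^2(D)$. Let $h \in C^{0,\alpha}(\overline D)$ (Hölder continuous on $\overline D$ with exponent $\alpha$) be harmonic in $D$. Then the integral equation $$u - \mu^2\, T u = h \quad \text{in } D$$ has a unique solution $u \in L^2(D)$. This solution (after modification on a null set) belongs to $C^{0,\alpha}(\overline D)$, satisfies the equation at every point of $D$, the integral being absolutely convergent there, and is $\mu$-panharmonic in $D$, that is, $u \in C^2(D)$ and $\nabla^2 u - \mu^2 u = 0$ in $D$. -/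

import Mathlib

open MeasureTheory Set
open scoped NNReal RealInnerProductSpace Laplacian

noncomputable section

/-- Near the point `p`, the set `D` is the strict epigraph, in the direction of a unit vector `e`,
of a Lipschitz function `φ` defined on the hyperplane orthogonal to `e`. -/
def IsLipschitzEpigraphNear {m : ℕ} (D : Set (EuclideanSpace ℝ (Fin m)))
    (p : EuclideanSpace ℝ (Fin m)) : Prop :=
  ∃ (e : EuclideanSpace ℝ (Fin m)) (K : ℝ≥0) (φ : (ℝ ∙ e)ᗮ → ℝ)
    (V : Set (EuclideanSpace ℝ (Fin m))),
    ‖e‖ = 1 ∧ LipschitzWith K φ ∧ IsOpen V ∧ p ∈ V ∧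
      ∀ x ∈ V, (x ∈ D ↔ φ ((ℝ ∙ e)ᗮ.orthogonalProjectionOnto x) < ⟪e, x⟫)

/-- A bounded Lipschitz domain: a bounded, (nonempty) connected open set which near each of its
boundary points is the epigraph of a Lipschitz function. -/
structure IsBoundedLipschitzDomain {m : ℕ} (D : Set (EuclideanSpace ℝ (Fin m))) : Prop where
  isOpen : IsOpen D
  isConnected : IsConnected D
  isBounded : Bornology.IsBounded D
  lipschitz_boundary : ∀ p ∈ frontier D, IsLipschitzEpigraphNear D p

/-- Membership in `C^{0,α}` of a set `S` (here always the compact closure of a bounded domain, so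
that Hölder continuity entails boundedness). -/
def IsHolderOn {m : ℕ} (α : ℝ≥0) (f : EuclideanSpace ℝ (Fin m) → ℝ)
    (S : Set (EuclideanSpace ℝ (Fin m))) : Prop :=
  ∃ C : ℝ≥0, HolderOnWith C α f S

/-- `u` is `μ`-panharmonic in the open set `D`: a `C²` solution of `∇²u - μ²u = 0` in `D`. -/
def IsPanharmonicOn {m : ℕ} (μ : ℝ) (u : EuclideanSpace ℝ (Fin m) → ℝ)
    (D : Set (EuclideanSpace ℝ (Fin m))) : Prop :=
  ContDiffOn ℝ 2 u D ∧ ∀ x ∈ D, Δ u x - μ ^ 2 * u x = 0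

/-- The total area `2 π^{m/2} / Γ(m/2)` of the unit sphere in `ℝ^m`. -/
def unitSphereArea (m : ℕ) : ℝ :=
  2 * Real.pi ^ ((m : ℝ) / 2) / Real.Gamma ((m : ℝ) / 2)

/-- The fundamental solution of the Laplace equation in `ℝ^m`, `m ≥ 3`. -/
def laplaceFundamentalSolution {m : ℕ} (x : EuclideanSpace ℝ (Fin m)) : ℝ :=
  ((2 - (m : ℝ)) * unitSphereArea m * ‖x‖ ^ (m - 2))⁻¹

/-- The Newtonian potential operator
`(T u)(x) = ∫_D E_m(x - y) u(y) dy`. -/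
def newtonianPotential {m : ℕ} (D : Set (EuclideanSpace ℝ (Fin m)))
    (u : EuclideanSpace ℝ (Fin m) → ℝ) (x : EuclideanSpace ℝ (Fin m)) : ℝ :=
  ∫ y in D, laplaceFundamentalSolution (x - y) * u y

/-- `u ∈ L²(D)` solves the integral equation `u - κ T u = h` in `L²(D)`, that is, almost everywhere
in `D`. (For bounded `D` and `u ∈ L²(D)` the integral defining `T u` converges absolutely
almost everywhere.) -/
def IsL2Solution {m : ℕ} (D : Set (EuclideanSpace ℝ (Fin m))) (κ : ℝ)
    (h u : EuclideanSpace ℝ (Fin m) → ℝ) : Prop :=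
  MemLp u 2 (volume.restrict D) ∧
    ∀ᵐ x ∂(volume.restrict D), u x - κ * newtonianPotential D u x = h x

end

noncomputable section

/-! ### Riesz kernels and the Newtonian potential of bounded functions -/

/-! Uniqueness is a sign argument. The kernel `E_m` is a negative multiple of `|x|^(2-m)`, and the
kernels `|x-y|^(-n)` are positive semidefinite: a Gamma integral writes them as superpositions of
Gaussians, and a Gaussian is a convolution of two Gaussians. Hence `⟨w, T w⟩ ≤ 0` on `L²(D)`
(`integral_mul_newtonianPotential_nonpos`), so `w = μ² T w` gives `‖w‖² = μ² ⟨w, T w⟩ ≤ 0`.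

Existence is obtained among the bounded continuous functions on `closure D` rather than in `L²`.
Potentials of bounded densities are bounded and Lipschitz (`exists_newtonianPotential_bound`), so
`T` is compact there by Arzelà–Ascoli; uniqueness excludes the eigenvalue `1` of `μ² T`, and the
Fredholm alternative yields a continuous solution (`exists_continuous_solution`). As `u = h + μ² T
u` with `T u` Lipschitz, `u` inherits the Hölder exponent of `h`.

Interior regularity is a bootstrap in the same identity. Near a point of `D` the density is cut off
to `g = χ u`. The remainder has a harmonic potential there, and `g ⋆ E` has gradient `g ⋆ ∇E`, so it
is one order smoother than `g`. Thus `u` continuous gives `T u` of class `C¹`, hence `u` is `C¹`,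
hence `T u` is `C²`. Poisson's equation `Δ(g ⋆ E) = g` (`laplacian_convPotential`) follows by moving
one derivative onto `g` and integrating along rays; it gives `Δ u = Δ h + μ² u = μ² u`. -/

theorem integrableOn_ball_inv_norm_pow {m k : ℕ} (hk : k < m) (R : ℝ) :
    IntegrableOn (fun z : EuclideanSpace ℝ (Fin m) => (‖z‖ ^ k)⁻¹) (Metric.ball 0 R) := by
  have hfr : Module.finrank ℝ (EuclideanSpace ℝ (Fin m)) = m := finrank_euclideanSpace_fin
  have : Nontrivial (EuclideanSpace ℝ (Fin m)) :=
    Module.nontrivial_of_finrank_pos (R := ℝ) (by rw [hfr]; omega)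
  rw [integrableOn_fun_norm_addHaar (μ := volume) (f := fun r : ℝ => (r ^ k)⁻¹), hfr]
  have h1 : IntegrableOn (fun y : ℝ => y ^ (m - 1 - k)) (Ioo 0 R) :=
    ((continuous_pow (m - 1 - k)).integrableOn_Icc).mono_set Ioo_subset_Icc_self
  refine h1.congr_fun (fun y hy => ?_) measurableSet_Ioo
  have hy0 : y ≠ 0 := hy.1.ne'
  have : m - 1 = (m - 1 - k) + k := by omega
  simp only [smul_eq_mul]
  rw [this, pow_add, mul_assoc, mul_inv_cancel₀ (pow_ne_zero _ hy0), mul_one]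
  congr 1; omega

theorem measurable_inv_norm_pow {m : ℕ} (k : ℕ) :
    Measurable (fun z : EuclideanSpace ℝ (Fin m) => (‖z‖ ^ k)⁻¹) :=
  (measurable_norm.pow_const k).inv

theorem locallyIntegrable_inv_norm_pow {m k : ℕ} (hk : k < m) :
    LocallyIntegrable (fun z : EuclideanSpace ℝ (Fin m) => (‖z‖ ^ k)⁻¹) := fun x =>
  ⟨Metric.ball 0 (‖x‖ + 1), Metric.isOpen_ball.mem_nhds (by simp),
    integrableOn_ball_inv_norm_pow hk _⟩

/-- Splits the kernel into an integrable singular part and a bounded part; translating the first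
costs nothing, which makes later bounds uniform in the centre. -/
theorem inv_norm_pow_le {m : ℕ} (k : ℕ) (z : EuclideanSpace ℝ (Fin m)) :
    (‖z‖ ^ k)⁻¹ ≤ (Metric.ball 0 1).indicator (fun z => (‖z‖ ^ k)⁻¹) z + 1 := by
  by_cases hz : z ∈ Metric.ball (0 : EuclideanSpace ℝ (Fin m)) 1
  · rw [indicator_of_mem hz]; linarith
  · rw [indicator_of_notMem hz, zero_add]
    have : 1 ≤ ‖z‖ := by simpa using hz
    exact inv_le_one_of_one_le₀ (one_le_pow₀ this)

/-- Riesz potentials of order below the dimension are uniformly bounded on sets of finite volume. -/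
theorem exists_setIntegral_inv_norm_pow_le {m k : ℕ} (hk : k < m)
    {S : Set (EuclideanSpace ℝ (Fin m))} (hS : volume S < ⊤) :
    ∃ M : ℝ, 0 ≤ M ∧ ∀ x, IntegrableOn (fun y => (‖x - y‖ ^ k)⁻¹) S ∧
      ∫ y in S, (‖x - y‖ ^ k)⁻¹ ≤ M := by
  set f : EuclideanSpace ℝ (Fin m) → ℝ := (Metric.ball 0 1).indicator fun z => (‖z‖ ^ k)⁻¹
  have hf0 : ∀ z, 0 ≤ f z := fun z => indicator_nonneg (fun z _ => by positivity) z
  have hf : Integrable f := (integrable_indicator_iff measurableSet_ball).2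
    (integrableOn_ball_inv_norm_pow hk 1)
  refine ⟨(∫ z, f z) + volume.real S, add_nonneg (integral_nonneg hf0) measureReal_nonneg,
    fun x => ?_⟩
  have hfx : Integrable fun y => f (x - y) := hf.comp_sub_left x
  have h1 : IntegrableOn (fun _ : EuclideanSpace ℝ (Fin m) => (1 : ℝ)) S :=
    integrableOn_const hS.ne
  have hdom : IntegrableOn (fun y => f (x - y) + 1) S := hfx.integrableOn.add h1
  have hint : IntegrableOn (fun y => (‖x - y‖ ^ k)⁻¹) S := by
    refine hdom.mono' ?_ (Filter.Eventually.of_forall fun y => ?_)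
    · exact ((measurable_inv_norm_pow k).comp (measurable_const.sub measurable_id)).aestronglyMeasurable
    · rw [Real.norm_of_nonneg (by positivity)]
      exact inv_norm_pow_le k (x - y)
  refine ⟨hint, ?_⟩
  calc ∫ y in S, (‖x - y‖ ^ k)⁻¹ ≤ ∫ y in S, (f (x - y) + 1) :=
        integral_mono hint hdom fun y => inv_norm_pow_le k (x - y)
    _ = (∫ y in S, f (x - y)) + volume.real S := by
        rw [integral_add hfx.integrableOn h1]; simp
    _ ≤ (∫ y, f (x - y)) + volume.real S := by
        gcongr
        · exact Filter.Eventually.of_forall fun y => hf0 _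
        · exact Measure.restrict_le_self
    _ = _ := by rw [integral_sub_left_eq_self f]

/-- The value at `r = 0` of the inverse power is the junk value `0`. -/
theorem inv_pow_sub_inv_pow_le {n : ℕ} (hn : 0 < n) {r s : ℝ} (hr : 0 ≤ r) (hrs : r ≤ s) :
    |(r ^ n)⁻¹ - (s ^ n)⁻¹| ≤ n * (s - r) * ((r ^ (n + 1))⁻¹ + (s ^ (n + 1))⁻¹) := by
  rcases hr.eq_or_lt with rfl | hr
  · rcases hrs.eq_or_lt with rfl | hs
    · simp
    · rw [zero_pow hn.ne', zero_pow (by omega), inv_zero, zero_sub, abs_neg, zero_add, sub_zero,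
        abs_of_nonneg (by positivity)]
      have : (s ^ n)⁻¹ = s * (s ^ (n + 1))⁻¹ := by field_simp; ring
      rw [this, mul_assoc]
      exact le_mul_of_one_le_left (by positivity) (by exact_mod_cast hn)
  · have hs : 0 < s := hr.trans_le hrs
    have hle : (s ^ n)⁻¹ ≤ (r ^ n)⁻¹ := by gcongr
    rw [abs_of_nonneg (sub_nonneg.2 hle)]
    -- Bernoulli's inequality, to be read as `1 - (r/s)^n ≤ n (1 - r/s)`.
    have hb : 1 + (n : ℝ) * (r / s - 1) ≤ (1 + (r / s - 1)) ^ n :=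
      one_add_mul_le_pow (by have : 0 ≤ r / s := by positivity
                             linarith) n
    have h1 : (r ^ n)⁻¹ - (s ^ n)⁻¹ = (r ^ n)⁻¹ * (1 - (r / s) ^ n) := by
      rw [div_pow]; field_simp
    have h2 : 1 - (r / s) ^ n ≤ n * (1 - r / s) := by
      have : 1 + (r / s - 1) = r / s := by ring
      rw [this] at hb; linarith
    have h3 : 1 - r / s ≤ (s - r) * r⁻¹ := by
      rw [one_sub_div hs.ne', div_eq_mul_inv]
      have : 0 ≤ s - r := sub_nonneg.2 hrs
      gcongr
    have h4 : (r ^ n)⁻¹ * (n * ((s - r) * r⁻¹)) = n * (s - r) * (r ^ (n + 1))⁻¹ := by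
      field_simp; ring
    have h5 : 0 ≤ n * (s - r) * (s ^ (n + 1))⁻¹ := by
      have : 0 ≤ s - r := sub_nonneg.2 hrs
      positivity
    rw [h1, mul_add]
    calc (r ^ n)⁻¹ * (1 - (r / s) ^ n) ≤ (r ^ n)⁻¹ * (n * ((s - r) * r⁻¹)) := by
          gcongr; exact h2.trans (by gcongr)
      _ = n * (s - r) * (r ^ (n + 1))⁻¹ := h4
      _ ≤ _ := by linarith

/-- For `n = m - 2` the right side has singularities of order `m - 1`, still below the dimension;
this is what makes potentials Lipschitz. -/
theorem abs_inv_norm_pow_sub_le {F : Type*} [NormedAddCommGroup F] {n : ℕ} (hn : 0 < n) (a b : F) :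
    |(‖a‖ ^ n)⁻¹ - (‖b‖ ^ n)⁻¹| ≤ n * ‖a - b‖ * ((‖a‖ ^ (n + 1))⁻¹ + (‖b‖ ^ (n + 1))⁻¹) := by
  rcases le_total ‖a‖ ‖b‖ with hab | hab
  · refine (inv_pow_sub_inv_pow_le hn (norm_nonneg _) hab).trans ?_
    gcongr
    rw [norm_sub_rev]; exact norm_sub_norm_le b a
  · rw [abs_sub_comm, add_comm]
    refine (inv_pow_sub_inv_pow_le hn (norm_nonneg _) hab).trans ?_
    gcongr
    exact norm_sub_norm_le a b

theorem unitSphereArea_pos {m : ℕ} (hm : 0 < m) : 0 < unitSphereArea m := by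
  have : (0 : ℝ) < m := by exact_mod_cast hm
  have := Real.Gamma_pos_of_pos (s := (m : ℝ) / 2) (by positivity)
  unfold unitSphereArea
  positivity

theorem laplaceFundamentalSolution_eq {m : ℕ} (x : EuclideanSpace ℝ (Fin m)) :
    laplaceFundamentalSolution x = ((2 - (m : ℝ)) * unitSphereArea m)⁻¹ * (‖x‖ ^ (m - 2))⁻¹ := by
  rw [laplaceFundamentalSolution, mul_inv]

theorem locallyIntegrable_laplaceFundamentalSolution {m : ℕ} (hm : 3 ≤ m) :
    LocallyIntegrable (laplaceFundamentalSolution (m := m)) := by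
  rw [funext laplaceFundamentalSolution_eq]
  exact (locallyIntegrable_inv_norm_pow (by omega)).smul
    (((2 - (m : ℝ)) * unitSphereArea m)⁻¹)

theorem integrableOn_laplaceFundamentalSolution_sub_mul {m : ℕ} (hm : 3 ≤ m)
    {S : Set (EuclideanSpace ℝ (Fin m))} (hS : MeasurableSet S) (hvol : volume S < ⊤)
    {u : EuclideanSpace ℝ (Fin m) → ℝ} (hu : AEStronglyMeasurable u (volume.restrict S))
    {B : ℝ} (hB : ∀ y ∈ S, |u y| ≤ B) (x : EuclideanSpace ℝ (Fin m)) :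
    IntegrableOn (fun y => laplaceFundamentalSolution (x - y) * u y) S := by
  obtain ⟨M, -, hM⟩ := exists_setIntegral_inv_norm_pow_le (m := m) (k := m - 2) (by omega) hvol
  refine Integrable.mul_bdd (c := B) ?_ hu ?_
  · simp only [laplaceFundamentalSolution_eq]
    exact (hM x).1.const_mul _
  · exact (ae_restrict_iff' hS).2 (Filter.Eventually.of_forall hB)

/-- Newtonian potentials of bounded densities are bounded and Lipschitz continuous. -/
theorem exists_newtonianPotential_bound {m : ℕ} (hm : 3 ≤ m)
    {S : Set (EuclideanSpace ℝ (Fin m))} (hS : MeasurableSet S) (hvol : volume S < ⊤) :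
    ∃ L : ℝ≥0, ∀ (u : EuclideanSpace ℝ (Fin m) → ℝ) (B : ℝ≥0),
      AEStronglyMeasurable u (volume.restrict S) → (∀ y ∈ S, |u y| ≤ B) →
      LipschitzWith (L * B) (newtonianPotential S u) ∧
      ∀ x, |newtonianPotential S u x| ≤ L * B := by
  obtain ⟨M₁, hM₁0, hM₁⟩ :=
    exists_setIntegral_inv_norm_pow_le (m := m) (k := m - 2) (by omega) hvol
  obtain ⟨M₂, hM₂0, hM₂⟩ :=
    exists_setIntegral_inv_norm_pow_le (m := m) (k := m - 2 + 1) (by omega) hvol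
  set c := ((2 - (m : ℝ)) * unitSphereArea m)⁻¹
  have hL0 : 0 ≤ |c| * M₁ + |c| * (m - 2 : ℕ) * (2 * M₂) := by positivity
  obtain ⟨L, hL⟩ : ∃ L : ℝ≥0, (L : ℝ) = |c| * M₁ + |c| * (m - 2 : ℕ) * (2 * M₂) :=
    ⟨⟨_, hL0⟩, rfl⟩
  refine ⟨L, fun u B hu hB => ⟨?_, fun x => ?_⟩⟩
  · refine LipschitzWith.of_dist_le_mul fun x x' => ?_
    rw [Real.dist_eq, dist_eq_norm]
    have hi := integrableOn_laplaceFundamentalSolution_sub_mul hm hS hvol hu hB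
    unfold newtonianPotential
    rw [← integral_sub (hi x) (hi x'), ← Real.norm_eq_abs]
    have hdom : IntegrableOn (fun y => (|c| * (m - 2 : ℕ) * ‖x - x'‖ * B) *
        ((‖x - y‖ ^ (m - 2 + 1))⁻¹ + (‖x' - y‖ ^ (m - 2 + 1))⁻¹)) S :=
      ((hM₂ x).1.add (hM₂ x').1).const_mul _
    refine (norm_integral_le_of_norm_le hdom ((ae_restrict_iff' hS).2
      (Filter.Eventually.of_forall fun y hy => ?_))).trans ?_
    · rw [← sub_mul, laplaceFundamentalSolution_eq, laplaceFundamentalSolution_eq, ← mul_sub,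
        norm_mul, norm_mul, Real.norm_eq_abs, Real.norm_eq_abs, Real.norm_eq_abs]
      have := abs_inv_norm_pow_sub_le (n := m - 2) (by omega) (x - y) (x' - y)
      rw [sub_sub_sub_cancel_right] at this
      calc _ ≤ |c| * ((m - 2 : ℕ) * ‖x - x'‖ *
            ((‖x - y‖ ^ (m - 2 + 1))⁻¹ + (‖x' - y‖ ^ (m - 2 + 1))⁻¹)) * B := by
            gcongr
            exact hB y hy
        _ = _ := by ring
    · rw [integral_const_mul, integral_add (hM₂ x).1 (hM₂ x').1]
      have h2 : (∫ y in S, (‖x - y‖ ^ (m - 2 + 1))⁻¹) + ∫ y in S, (‖x' - y‖ ^ (m - 2 + 1))⁻¹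
          ≤ 2 * M₂ := by linarith [(hM₂ x).2, (hM₂ x').2]
      calc _ ≤ |c| * (m - 2 : ℕ) * ‖x - x'‖ * B * (2 * M₂) := by gcongr
        _ = (0 + |c| * (m - 2 : ℕ) * (2 * M₂)) * B * ‖x - x'‖ := by ring
        _ ≤ (|c| * M₁ + |c| * (m - 2 : ℕ) * (2 * M₂)) * B * ‖x - x'‖ := by
            gcongr; positivity
        _ = _ := by rw [NNReal.coe_mul, hL]
  · rw [newtonianPotential, ← Real.norm_eq_abs]
    have hdom : IntegrableOn (fun y => (|c| * B) * (‖x - y‖ ^ (m - 2))⁻¹) S :=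
      (hM₁ x).1.const_mul _
    refine (norm_integral_le_of_norm_le hdom ((ae_restrict_iff' hS).2
      (Filter.Eventually.of_forall fun y hy => ?_))).trans ?_
    · rw [laplaceFundamentalSolution_eq, norm_mul, norm_mul, Real.norm_eq_abs, Real.norm_eq_abs,
        Real.norm_eq_abs, abs_of_nonneg (a := (‖x - y‖ ^ (m - 2))⁻¹) (by positivity)]
      calc _ ≤ |c| * (‖x - y‖ ^ (m - 2))⁻¹ * B := by gcongr; exact hB y hy
        _ = _ := by ring
    · rw [integral_const_mul]
      calc _ ≤ |c| * B * M₁ := by gcongr; exact (hM₁ x).2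
        _ = (|c| * M₁ + 0) * B := by ring
        _ ≤ (|c| * M₁ + |c| * (m - 2 : ℕ) * (2 * M₂)) * B := by gcongr; positivity
        _ = _ := by rw [hL]

/-! ### Positivity of the Riesz kernel and uniqueness in `L²` -/

/-- A superposition `k y = ∫ κ y s` of nonnegative kernels inherits the positivity of the integrals
`∫ f κ(·, s)`. -/
theorem integral_mul_nonneg_of_kernel_eq_integral {Y S : Type*} [MeasurableSpace Y]
    [MeasurableSpace S] {ν : Measure Y} {ρ : Measure S} [SFinite ν] [SFinite ρ]
    {f : Y → ℝ} {k : Y → ℝ} {κ : Y → S → ℝ} (hf : AEStronglyMeasurable f ν)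
    (hκ : Measurable (Function.uncurry κ)) (hκ0 : ∀ᵐ s ∂ρ, ∀ y, 0 ≤ κ y s)
    (hκi : ∀ᵐ y ∂ν, Integrable (κ y) ρ) (hk : ∀ᵐ y ∂ν, k y = ∫ s, κ y s ∂ρ)
    (hfk : Integrable (fun y => f y * k y) ν)
    (hpos : ∀ᵐ s ∂ρ, 0 ≤ ∫ y, f y * κ y s ∂ν) :
    0 ≤ ∫ y, f y * k y ∂ν := by
  have hmeas : AEStronglyMeasurable (Function.uncurry fun y s => f y * κ y s) (ν.prod ρ) :=
    hf.comp_fst.mul hκ.aestronglyMeasurable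
  have hint : Integrable (Function.uncurry fun y s => f y * κ y s) (ν.prod ρ) := by
    refine (integrable_prod_iff hmeas).2 ⟨?_, ?_⟩
    · filter_upwards [hκi] with y hy using hy.const_mul (f y)
    · refine hfk.norm.congr ?_
      filter_upwards [hk, hκi] with y hy hyi
      simp only [Function.uncurry_apply_pair, norm_mul]
      rw [integral_const_mul, hy]
      congr 1
      rw [Real.norm_of_nonneg (integral_nonneg_of_ae (by filter_upwards [hκ0] with s hs using hs y))]
      refine integral_congr_ae ?_
      filter_upwards [hκ0] with s hs
      rw [Real.norm_of_nonneg (hs y)]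
  have h1 : ∫ y, f y * k y ∂ν = ∫ y, ∫ s, f y * κ y s ∂ρ ∂ν := by
    refine integral_congr_ae ?_
    filter_upwards [hk] with y hy
    rw [hy, integral_const_mul]
  rw [h1, integral_integral_swap hint]
  exact integral_nonneg_of_ae hpos

section Gaussian

variable {V : Type*} [NormedAddCommGroup V] [InnerProductSpace ℝ V]

/-- The parallelogram law about the midpoint. Multiplied by `-2s` and exponentiated, it turns a
product of Gaussians centred at `x` and `y` into `exp(-s‖x-y‖²)` times a Gaussian in `z`. -/
theorem norm_sub_sq_add_norm_sub_sq_eq (x y z : V) :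
    ‖x - z‖ ^ 2 + ‖y - z‖ ^ 2 = 2 * ‖z - (2⁻¹ : ℝ) • (x + y)‖ ^ 2 + ‖x - y‖ ^ 2 / 2 := by
  have key : ∀ a b : V, ‖a‖ ^ 2 + ‖b‖ ^ 2 = 2 * ‖(2⁻¹ : ℝ) • (a + b)‖ ^ 2 + ‖a - b‖ ^ 2 / 2 := by
    intro a b
    rw [norm_smul, mul_pow, norm_add_sq_real, norm_sub_sq_real]
    norm_num; ring
  have h := key (x - z) (y - z)
  rw [sub_sub_sub_cancel_right] at h
  rw [h, ← norm_neg (z - _)]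
  congr 4
  module

variable [FiniteDimensional ℝ V] [MeasurableSpace V] [BorelSpace V]

theorem integrable_exp_neg_mul_norm_sq {s : ℝ} (hs : 0 < s) :
    Integrable fun z : V => Real.exp (-s * ‖z‖ ^ 2) := by
  have h := (GaussianFourier.integrable_cexp_neg_mul_sq_norm_add (V := V) (b := (s : ℂ))
    (by simpa using hs) 0 0).norm
  refine h.congr (Filter.Eventually.of_forall fun z => ?_)
  simp [Complex.norm_exp, ← Complex.ofReal_pow]

/-- The Gaussian kernel is positive semidefinite. -/
theorem integral_mul_gaussian_nonneg {ν : Measure V} [SFinite ν] {w : V → ℝ} (hw : Integrable w ν)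
    {s : ℝ} (hs : 0 < s) :
    0 ≤ ∫ p, (w p.1 * w p.2) * Real.exp (-s * ‖p.1 - p.2‖ ^ 2) ∂(ν.prod ν) := by
  set A : ℝ := ∫ z : V, Real.exp (-(4 * s) * ‖z‖ ^ 2)
  have hA : 0 < A := integral_exp_pos (integrable_exp_neg_mul_norm_sq (by positivity))
  have hww : Integrable (fun p : V × V => w p.1 * w p.2) (ν.prod ν) := hw.mul_prod hw
  have hexp : ∀ x y z : V, Real.exp (-(2 * s) * ‖x - z‖ ^ 2) * Real.exp (-(2 * s) * ‖y - z‖ ^ 2) =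
      Real.exp (-s * ‖x - y‖ ^ 2) * Real.exp (-(4 * s) * ‖z - (2⁻¹ : ℝ) • (x + y)‖ ^ 2) := by
    intro x y z
    rw [← Real.exp_add, ← Real.exp_add]
    congr 1
    linear_combination (-(2 * s)) * norm_sub_sq_add_norm_sub_sq_eq x y z
  have key : 0 ≤ ∫ p, (w p.1 * w p.2) * (A * Real.exp (-s * ‖p.1 - p.2‖ ^ 2)) ∂(ν.prod ν) := by
    refine integral_mul_nonneg_of_kernel_eq_integral (ρ := (volume : Measure V))
      (κ := fun p z => Real.exp (-(2 * s) * ‖p.1 - z‖ ^ 2) * Real.exp (-(2 * s) * ‖p.2 - z‖ ^ 2))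
      hww.aestronglyMeasurable ?_ ?_ ?_ ?_ ?_ ?_
    · unfold Function.uncurry; fun_prop
    · exact Filter.Eventually.of_forall fun z p => by positivity
    · refine Filter.Eventually.of_forall fun p => ?_
      simp only [hexp]
      exact ((integrable_exp_neg_mul_norm_sq (V := V) (s := 4 * s)
        (by positivity)).comp_sub_right _).const_mul _
    · refine Filter.Eventually.of_forall fun p => ?_
      simp only [hexp]
      rw [integral_const_mul,
        integral_sub_right_eq_self (fun z : V => Real.exp (-(4 * s) * ‖z‖ ^ 2)), mul_comm]
    · refine hww.mul_bdd (c := A) ?_ (Filter.Eventually.of_forall fun p => ?_)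
      · refine Measurable.aestronglyMeasurable ?_; fun_prop
      · rw [Real.norm_of_nonneg (by positivity)]
        refine mul_le_of_le_one_right hA.le (Real.exp_le_one_iff.2 ?_)
        have : 0 ≤ s * ‖p.1 - p.2‖ ^ 2 := by positivity
        linarith
    · refine Filter.Eventually.of_forall fun z => ?_
      -- For fixed `z` the kernel is a product of one function of `x` and the same function of `y`,
      -- so the double integral is a square.
      have : ∀ p : V × V, w p.1 * w p.2 *
          (Real.exp (-(2 * s) * ‖p.1 - z‖ ^ 2) * Real.exp (-(2 * s) * ‖p.2 - z‖ ^ 2)) =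
          (w p.1 * Real.exp (-(2 * s) * ‖p.1 - z‖ ^ 2)) *
          (w p.2 * Real.exp (-(2 * s) * ‖p.2 - z‖ ^ 2)) := fun p => by ring
      simp only [this]
      rw [integral_prod_mul (fun x => w x * Real.exp (-(2 * s) * ‖x - z‖ ^ 2))
        (fun x => w x * Real.exp (-(2 * s) * ‖x - z‖ ^ 2))]
      exact mul_self_nonneg _
  have : ∀ p : V × V, (w p.1 * w p.2) * (A * Real.exp (-s * ‖p.1 - p.2‖ ^ 2)) =
      A * ((w p.1 * w p.2) * Real.exp (-s * ‖p.1 - p.2‖ ^ 2)) := fun p => by ring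
  simp only [this, integral_const_mul] at key
  exact nonneg_of_mul_nonneg_right key hA

end Gaussian

theorem integral_rpow_mul_exp_neg_mul_sq {n : ℕ} (hn : 0 < n) {r : ℝ} (hr : 0 < r) :
    ∫ s in Ioi (0 : ℝ), s ^ ((n : ℝ) / 2 - 1) * Real.exp (-s * r ^ 2) =
      Real.Gamma ((n : ℝ) / 2) * (r ^ n)⁻¹ := by
  have hn' : (0 : ℝ) < n / 2 := by positivity
  have h := Real.integral_rpow_mul_exp_neg_mul_Ioi hn' (r := r ^ 2) (by positivity)
  have e : ∀ s : ℝ, -s * r ^ 2 = -(r ^ 2 * s) := fun s => by ring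
  simp only [e]
  rw [h, mul_comm]
  congr 1
  rw [one_div, ← Real.rpow_natCast r 2, Real.inv_rpow (by positivity), ← Real.rpow_mul hr.le,
    ← Real.rpow_natCast r n]
  congr 2
  push_cast; ring

/-- The kernel `|x - y|⁻ⁿ` is positive semidefinite. -/
theorem integral_mul_inv_norm_pow_nonneg {m n : ℕ} (hn : 0 < n)
    {ν : Measure (EuclideanSpace ℝ (Fin m))} [SFinite ν] [NullSingletonClass ν]
    {w : EuclideanSpace ℝ (Fin m) → ℝ}
    (hw : Integrable w ν)
    (hww : Integrable (fun p : EuclideanSpace ℝ (Fin m) × EuclideanSpace ℝ (Fin m) =>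
      w p.1 * w p.2 * (‖p.1 - p.2‖ ^ n)⁻¹) (ν.prod ν)) :
    0 ≤ ∫ p, w p.1 * w p.2 * (‖p.1 - p.2‖ ^ n)⁻¹ ∂(ν.prod ν) := by
  have hG : 0 < Real.Gamma ((n : ℝ) / 2) := Real.Gamma_pos_of_pos (by positivity)
  have hne : ∀ᵐ p ∂(ν.prod ν), 0 < ‖p.1 - p.2‖ := by
    have : ∀ᵐ p ∂(ν.prod ν), p.1 ≠ p.2 := by
      refine (Measure.ae_prod_iff_ae_ae (p := fun p : EuclideanSpace ℝ (Fin m) ×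
        EuclideanSpace ℝ (Fin m) => p.1 ≠ p.2)
        (measurableSet_eq_fun measurable_fst measurable_snd).compl).2
        (Filter.Eventually.of_forall fun x => ?_)
      have := (measure_singleton (μ := ν) x)
      filter_upwards [compl_mem_ae_iff.2 this] with y hy h
      exact hy h.symm
    filter_upwards [this] with p hp using norm_pos_iff.2 (sub_ne_zero.2 hp)
  have hval : ∀ᵐ p ∂(ν.prod ν), Real.Gamma ((n : ℝ) / 2) * (‖p.1 - p.2‖ ^ n)⁻¹ =
      ∫ s in Ioi (0 : ℝ), s ^ ((n : ℝ) / 2 - 1) * Real.exp (-s * ‖p.1 - p.2‖ ^ 2) := by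
    filter_upwards [hne] with p hp using (integral_rpow_mul_exp_neg_mul_sq hn hp).symm
  have key : 0 ≤ ∫ p, (w p.1 * w p.2) * (Real.Gamma ((n : ℝ) / 2) * (‖p.1 - p.2‖ ^ n)⁻¹)
      ∂(ν.prod ν) := by
    refine integral_mul_nonneg_of_kernel_eq_integral (ρ := volume.restrict (Ioi (0 : ℝ)))
      (κ := fun p s => s ^ ((n : ℝ) / 2 - 1) * Real.exp (-s * ‖p.1 - p.2‖ ^ 2))
      (hw.mul_prod hw).aestronglyMeasurable ?_ ?_ ?_ hval ?_ ?_
    · unfold Function.uncurry; fun_prop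
    · filter_upwards [ae_restrict_mem measurableSet_Ioi] with s hs p
      have : 0 ≤ s ^ ((n : ℝ) / 2 - 1) := Real.rpow_nonneg (le_of_lt hs) _
      positivity
    · filter_upwards [hne, hval] with p hp hpv
      -- The integral of a non-integrable function is `0` by convention; here its value is positive,
      -- so integrability follows.
      refine not_imp_comm.1 integral_undef ?_
      rw [← hpv]; positivity
    · have e : ∀ p : EuclideanSpace ℝ (Fin m) × EuclideanSpace ℝ (Fin m),
        (w p.1 * w p.2) * (Real.Gamma ((n : ℝ) / 2) * (‖p.1 - p.2‖ ^ n)⁻¹) =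
        Real.Gamma ((n : ℝ) / 2) * (w p.1 * w p.2 * (‖p.1 - p.2‖ ^ n)⁻¹) := fun p => by ring
      simp only [e]
      exact hww.const_mul _
    · filter_upwards [ae_restrict_mem measurableSet_Ioi] with s hs
      have e : ∀ p : EuclideanSpace ℝ (Fin m) × EuclideanSpace ℝ (Fin m),
        (w p.1 * w p.2) * (s ^ ((n : ℝ) / 2 - 1) * Real.exp (-s * ‖p.1 - p.2‖ ^ 2)) =
        s ^ ((n : ℝ) / 2 - 1) * ((w p.1 * w p.2) * Real.exp (-s * ‖p.1 - p.2‖ ^ 2)) :=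
        fun p => by ring
      simp only [e, integral_const_mul]
      exact mul_nonneg (Real.rpow_nonneg (le_of_lt hs) _) (integral_mul_gaussian_nonneg hw hs)
  have e : ∀ p : EuclideanSpace ℝ (Fin m) × EuclideanSpace ℝ (Fin m),
    (w p.1 * w p.2) * (Real.Gamma ((n : ℝ) / 2) * (‖p.1 - p.2‖ ^ n)⁻¹) =
    Real.Gamma ((n : ℝ) / 2) * (w p.1 * w p.2 * (‖p.1 - p.2‖ ^ n)⁻¹) := fun p => by ring
  simp only [e, integral_const_mul] at key
  exact nonneg_of_mul_nonneg_right key hG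

section Uniqueness

variable {m : ℕ} {D : Set (EuclideanSpace ℝ (Fin m))}

/-- Tonelli: integrating in `p.1` first leaves at most `M |f|`, with `M` the uniform bound on Riesz
potentials. -/
theorem integrable_mul_inv_norm_pow_prod {k : ℕ} (hk : k < m) (hvol : volume D < ⊤)
    {f : EuclideanSpace ℝ (Fin m) → ℝ} (hf : IntegrableOn f D) :
    Integrable (fun p : EuclideanSpace ℝ (Fin m) × EuclideanSpace ℝ (Fin m) =>
      f p.2 * (‖p.1 - p.2‖ ^ k)⁻¹) ((volume.restrict D).prod (volume.restrict D)) := by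
  obtain ⟨M, hM0, hM⟩ := exists_setIntegral_inv_norm_pow_le (m := m) hk hvol
  have hmeas : AEStronglyMeasurable
      (fun p : EuclideanSpace ℝ (Fin m) × EuclideanSpace ℝ (Fin m) =>
      f p.2 * (‖p.1 - p.2‖ ^ k)⁻¹) ((volume.restrict D).prod (volume.restrict D)) :=
    hf.aestronglyMeasurable.comp_snd.mul
      ((measurable_inv_norm_pow k).comp (measurable_fst.sub measurable_snd)).aestronglyMeasurable
  refine (integrable_prod_iff' hmeas).2 ⟨Filter.Eventually.of_forall fun y => ?_, ?_⟩
  · have := (hM y).1.const_mul (f y)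
    simpa only [norm_sub_rev y] using! this
  · refine (hf.norm.mul_const M).mono' ?_ (Filter.Eventually.of_forall fun y => ?_)
    · exact hmeas.norm.prod_swap.integral_prod_right'
    · simp only [norm_mul]
      rw [integral_const_mul, norm_mul, norm_norm]
      gcongr
      rw [Real.norm_of_nonneg (integral_nonneg fun x => by positivity)]
      refine le_trans (le_of_eq ?_) (hM y).2
      refine integral_congr_ae (Filter.Eventually.of_forall fun x => ?_)
      simp only
      rw [Real.norm_of_nonneg (by positivity), norm_sub_rev]

theorem ae_integrableOn_laplaceFundamentalSolution_sub_mul (hm : 3 ≤ m) (hvol : volume D < ⊤)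
    {f : EuclideanSpace ℝ (Fin m) → ℝ} (hf : IntegrableOn f D) :
    ∀ᵐ x ∂(volume.restrict D),
      IntegrableOn (fun y => laplaceFundamentalSolution (x - y) * f y) D := by
  filter_upwards [(integrable_mul_inv_norm_pow_prod (k := m - 2) (by omega) hvol hf).prod_right_ae]
    with x hx
  refine (hx.const_mul (((2 - (m : ℝ)) * unitSphereArea m)⁻¹)).congr
    (Filter.Eventually.of_forall fun y => ?_)
  simp only [laplaceFundamentalSolution_eq]
  ring

/-- The normalising factor `(2 - m) ω_m` is negative, so positivity of the Riesz kernel becomes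
negativity of `T`. -/
theorem integral_mul_newtonianPotential_nonpos (hm : 3 ≤ m) (hvol : volume D < ⊤)
    {w : EuclideanSpace ℝ (Fin m) → ℝ} (hw : MemLp w 2 (volume.restrict D)) :
    Integrable (fun x => w x * newtonianPotential D w x) (volume.restrict D) ∧
      ∫ x in D, w x * newtonianPotential D w x ≤ 0 := by
  have : IsFiniteMeasure (volume.restrict D) := ⟨by simpa using hvol⟩
  have hw1 : IntegrableOn w D := hw.integrable (by norm_num)
  have hw2 : IntegrableOn (fun x => w x ^ 2) D := hw.integrable_sq
  have h2 := integrable_mul_inv_norm_pow_prod (m := m) (k := m - 2) (by omega) hvol hw2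
  have h1 := h2.swap
  have hww : Integrable (fun p : EuclideanSpace ℝ (Fin m) × EuclideanSpace ℝ (Fin m) =>
      w p.1 * w p.2 * (‖p.1 - p.2‖ ^ (m - 2))⁻¹)
      ((volume.restrict D).prod (volume.restrict D)) := by
    -- `|ab| ≤ a² + b²` reduces the claim to the integrable density `w²` in each variable.
    refine (h1.add h2).mono' ?_ (Filter.Eventually.of_forall fun p => ?_)
    · exact (hw1.aestronglyMeasurable.comp_fst.mul hw1.aestronglyMeasurable.comp_snd).mul
        ((measurable_inv_norm_pow (m - 2)).comp
          (measurable_fst.sub measurable_snd)).aestronglyMeasurable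
    · simp only [Pi.add_apply, Function.comp_apply, Prod.snd_swap, Prod.fst_swap]
      rw [norm_mul, norm_sub_rev p.2 p.1, ← add_mul,
        Real.norm_of_nonneg (r := (‖p.1 - p.2‖ ^ (m - 2))⁻¹) (by positivity)]
      gcongr
      rw [Real.norm_eq_abs, abs_le]
      constructor <;> nlinarith [sq_nonneg (w p.1 + w p.2), sq_nonneg (w p.1 - w p.2)]
  have : Nontrivial (EuclideanSpace ℝ (Fin m)) := Module.nontrivial_of_finrank_pos (R := ℝ)
    (by rw [finrank_euclideanSpace_fin]; omega)
  have hpos := integral_mul_inv_norm_pow_nonneg (n := m - 2) (by omega) hw1 hww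
  set c := ((2 - (m : ℝ)) * unitSphereArea m)⁻¹
  have hc : c ≤ 0 := by
    have h3 : (3 : ℝ) ≤ m := by exact_mod_cast hm
    have := unitSphereArea_pos (m := m) (by omega)
    exact inv_nonpos.2 (mul_nonpos_of_nonpos_of_nonneg (by linarith) this.le)
  have e : ∀ x, w x * newtonianPotential D w x =
      c * ∫ y in D, w x * w y * (‖x - y‖ ^ (m - 2))⁻¹ := fun x => by
    simp only [newtonianPotential, laplaceFundamentalSolution_eq]
    rw [← integral_const_mul, ← integral_const_mul]
    congr 1; ext y; ring
  simp only [e]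
  refine ⟨hww.integral_prod_left.const_mul c, ?_⟩
  rw [integral_const_mul, ← integral_prod _ hww]
  exact mul_nonpos_of_nonpos_of_nonneg hc hpos

/-- The homogeneous equation `w - κ T w = 0`, `κ ≥ 0`, has only the trivial solution in `L²`. -/
theorem ae_eq_zero_of_sub_mul_newtonianPotential_eq_zero (hm : 3 ≤ m) (hvol : volume D < ⊤)
    {κ : ℝ} (hκ : 0 ≤ κ) {w : EuclideanSpace ℝ (Fin m) → ℝ} (hw : MemLp w 2 (volume.restrict D))
    (heq : ∀ᵐ x ∂(volume.restrict D), w x - κ * newtonianPotential D w x = 0) :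
    w =ᵐ[volume.restrict D] 0 := by
  obtain ⟨-, hle⟩ := integral_mul_newtonianPotential_nonpos hm hvol hw
  have h1 : ∫ x in D, w x ^ 2 = κ * ∫ x in D, w x * newtonianPotential D w x := by
    rw [← integral_const_mul]
    refine integral_congr_ae ?_
    filter_upwards [heq] with x hx
    linear_combination w x * hx
  have h2 : ∫ x in D, w x ^ 2 = 0 :=
    le_antisymm (h1 ▸ mul_nonpos_of_nonneg_of_nonpos hκ hle) (integral_nonneg fun x => sq_nonneg _)
  rw [integral_eq_zero_iff_of_nonneg (fun x => sq_nonneg _) hw.integrable_sq] at h2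
  filter_upwards [h2] with x hx
  simpa using hx

/-- The difference solves the homogeneous equation. Splitting its potential needs both integrals to
converge absolutely, which holds almost everywhere. -/
theorem IsL2Solution.ae_eq (hm : 3 ≤ m) (hvol : volume D < ⊤) {κ : ℝ} (hκ : 0 ≤ κ)
    {h u v : EuclideanSpace ℝ (Fin m) → ℝ} (hu : IsL2Solution D κ h u)
    (hv : IsL2Solution D κ h v) : v =ᵐ[volume.restrict D] u := by
  have : IsFiniteMeasure (volume.restrict D) := ⟨by simpa using hvol⟩
  have hui : IntegrableOn u D := hu.1.integrable (by norm_num)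
  have hvi : IntegrableOn v D := hv.1.integrable (by norm_num)
  have h0 := ae_eq_zero_of_sub_mul_newtonianPotential_eq_zero hm hvol hκ (hv.1.sub hu.1) (by
    filter_upwards [hu.2, hv.2, ae_integrableOn_laplaceFundamentalSolution_sub_mul hm hvol hui,
      ae_integrableOn_laplaceFundamentalSolution_sub_mul hm hvol hvi] with x hux hvx hxu hxv
    have : newtonianPotential D (v - u) x = newtonianPotential D v x - newtonianPotential D u x := by
      simp only [newtonianPotential, Pi.sub_apply, mul_sub]
      exact integral_sub hxv hxu
    rw [this, Pi.sub_apply]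
    linarith)
  filter_upwards [h0] with x hx
  simpa [sub_eq_zero] using hx

end Uniqueness

/-! ### Continuous solutions by the Fredholm alternative -/

section Fredholm

open scoped BoundedContinuousFunction

variable {m : ℕ} {D : Set (EuclideanSpace ℝ (Fin m))}

theorem extend_val_apply {X : Type*} {S : Set X} (f : S → ℝ) {x : X} (hx : x ∈ S) :
    Function.extend Subtype.val f 0 x = f ⟨x, hx⟩ :=
  Subtype.val_injective.extend_apply f 0 ⟨x, hx⟩

theorem continuousOn_extend_val {X : Type*} [TopologicalSpace X] {S : Set X} {f : S → ℝ}
    (hf : Continuous f) : ContinuousOn (Function.extend Subtype.val f 0) S := by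
  rw [continuousOn_iff_continuous_domRestrict]
  convert hf using 1
  ext x
  exact extend_val_apply f x.2

theorem newtonianPotential_congr_ae {u v : EuclideanSpace ℝ (Fin m) → ℝ}
    (huv : u =ᵐ[volume.restrict D] v) (x : EuclideanSpace ℝ (Fin m)) :
    newtonianPotential D u x = newtonianPotential D v x := by
  refine integral_congr_ae ?_
  filter_upwards [huv] with y hy
  rw [hy]

/-- The Newtonian potential operator on the bounded continuous functions on `closure D`. -/
theorem exists_compact_newtonian_operator (hm : 3 ≤ m) (hD : IsOpen D)
    (hb : Bornology.IsBounded D) :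
    ∃ T : (closure D →ᵇ ℝ) →L[ℝ] (closure D →ᵇ ℝ), IsCompactOperator T ∧
      ∀ f x, T f x = newtonianPotential D (Function.extend Subtype.val f 0) x := by
  have hvol : volume D < ⊤ := hb.measure_lt_top
  obtain ⟨L, hL⟩ := exists_newtonianPotential_bound hm hD.measurableSet hvol
  have hmeas : ∀ f : closure D →ᵇ ℝ,
      AEStronglyMeasurable (Function.extend Subtype.val f 0) (volume.restrict D) := fun f =>
    ((continuousOn_extend_val f.continuous).mono subset_closure).aestronglyMeasurable
      hD.measurableSet
  have hbd : ∀ f : closure D →ᵇ ℝ, ∀ y ∈ D, |Function.extend Subtype.val f 0 y| ≤ ‖f‖₊ := by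
    intro f y hy
    rw [extend_val_apply f (subset_closure hy)]
    exact f.norm_coe_le_norm _
  have hT := fun f : closure D →ᵇ ℝ => hL _ ‖f‖₊ (hmeas f) (hbd f)
  have hint := fun (f : closure D →ᵇ ℝ) x =>
    integrableOn_laplaceFundamentalSolution_sub_mul hm hD.measurableSet hvol (hmeas f) (hbd f) x
  let T₀ : (closure D →ᵇ ℝ) →ₗ[ℝ] (closure D →ᵇ ℝ) :=
    { toFun := fun f => BoundedContinuousFunction.ofNormedAddCommGroup
        (fun x : closure D => newtonianPotential D (Function.extend Subtype.val f 0) x)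
        ((hT f).1.continuous.comp continuous_subtype_val) (L * ‖f‖) (fun x => (hT f).2 x)
      map_add' := fun f g => by
        ext x
        simp only [BoundedContinuousFunction.coe_ofNormedAddCommGroup,
          BoundedContinuousFunction.coe_add, Pi.add_apply, newtonianPotential]
        rw [← integral_add (hint f x) (hint g x)]
        refine setIntegral_congr_fun hD.measurableSet fun y hy => ?_
        have hy' := subset_closure hy
        simp only [extend_val_apply _ hy', Pi.add_apply]
        ring
      map_smul' := fun a f => by
        ext x
        simp only [BoundedContinuousFunction.coe_ofNormedAddCommGroup,
          BoundedContinuousFunction.coe_smul, newtonianPotential, RingHom.id_apply, smul_eq_mul]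
        rw [← integral_const_mul]
        refine setIntegral_congr_fun hD.measurableSet fun y hy => ?_
        have hy' := subset_closure hy
        simp only [extend_val_apply _ hy']
        ring }
  have hT₀ : ∀ f x, T₀ f x = newtonianPotential D (Function.extend Subtype.val f 0) x :=
    fun f x => rfl
  let T : (closure D →ᵇ ℝ) →L[ℝ] (closure D →ᵇ ℝ) := T₀.mkContinuous L fun f =>
    (BoundedContinuousFunction.norm_le (by positivity)).2 fun x => (hT f).2 x
  refine ⟨T, ?_, hT₀⟩
  have : CompactSpace (closure D) := isCompact_iff_compactSpace.1 hb.isCompact_closure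
  change IsCompactOperator T₀
  refine (isCompactOperator_iff_isCompact_closure_image_closedBall T₀ one_pos).2 ?_
  -- The image of the unit ball takes values in `[-L, L]` and consists of `L`-Lipschitz functions.
  refine BoundedContinuousFunction.arzela_ascoli (Metric.closedBall 0 L)
    (isCompact_closedBall _ _) _ ?_ ?_
  · rintro _ x ⟨f, hf, rfl⟩
    have hf1 : ‖f‖ ≤ 1 := by simpa using hf
    rw [mem_closedBall_zero_iff]
    exact ((hT f).2 x).trans (mul_le_of_le_one_right L.2 hf1)
  · refine LipschitzWith.uniformEquicontinuous _ L ?_ |>.equicontinuous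
    rintro ⟨_, f, hf, rfl⟩
    have hf1 : ‖f‖₊ ≤ 1 := by
      have : ‖f‖ ≤ 1 := by simpa using hf
      exact_mod_cast this
    refine LipschitzWith.weaken ?_ (mul_le_of_le_one_right (zero_le) hf1 : L * ‖f‖₊ ≤ L)
    exact fun x y => (hT f).1 x y

theorem exists_continuous_solution (hm : 3 ≤ m) (hD : IsOpen D) (hb : Bornology.IsBounded D)
    {κ : ℝ} (hκ : 0 ≤ κ) {h : EuclideanSpace ℝ (Fin m) → ℝ} (hh : ContinuousOn h (closure D)) :
    ∃ u : EuclideanSpace ℝ (Fin m) → ℝ, ContinuousOn u (closure D) ∧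
      ∀ x ∈ closure D, u x - κ * newtonianPotential D u x = h x := by
  have hvol : volume D < ⊤ := hb.measure_lt_top
  have : IsFiniteMeasure (volume.restrict D) := ⟨by simpa using hvol⟩
  have : CompactSpace (closure D) := isCompact_iff_compactSpace.1 hb.isCompact_closure
  obtain ⟨T, hTc, hT⟩ := exists_compact_newtonian_operator hm hD hb
  have hno : ¬ Module.End.HasEigenvalue ((κ • T : (closure D →ᵇ ℝ) →L[ℝ] (closure D →ᵇ ℝ)) :
      Module.End ℝ (closure D →ᵇ ℝ)) 1 := by
    intro hev
    obtain ⟨f, hf⟩ := hev.exists_hasEigenvector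
    have hfe : ∀ x, κ * T f x = f x := fun x => by
      have := congrArg (fun g : closure D →ᵇ ℝ => g x) hf.apply_eq_smul
      simpa using this
    set w := Function.extend Subtype.val f 0
    have hwv : ∀ x (hx : x ∈ closure D), w x = f ⟨x, hx⟩ := fun x hx => extend_val_apply f hx
    have hwc : ContinuousOn w D := (continuousOn_extend_val f.continuous).mono subset_closure
    have hw : MemLp w 2 (volume.restrict D) := by
      refine MemLp.of_bound (hwc.aestronglyMeasurable hD.measurableSet) ‖f‖
        ((ae_restrict_iff' hD.measurableSet).2 (Filter.Eventually.of_forall fun y hy => ?_))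
      rw [hwv y (subset_closure hy)]
      exact f.norm_coe_le_norm _
    have h0 := ae_eq_zero_of_sub_mul_newtonianPotential_eq_zero hm hvol hκ hw
      ((ae_restrict_iff' hD.measurableSet).2 (Filter.Eventually.of_forall fun y hy => by
        rw [hwv y (subset_closure hy), ← hfe, hT, sub_self]))
    -- `w` is known to vanish only almost everywhere in `D`, but `T f` depends only on that class;
    -- so `f = κ T f` vanishes at every point of `closure D`, boundary included.
    refine hf.2 ?_
    ext x
    rw [← hfe, hT, newtonianPotential_congr_ae h0]
    simp [newtonianPotential]
  have hres := (IsCompactOperator.hasEigenvalue_or_mem_resolventSet (hTc.smul κ)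
    (one_ne_zero' ℝ)).resolve_left hno
  rw [spectrum.mem_resolventSet_iff, map_one] at hres
  obtain ⟨e, he⟩ := hres
  let h' : closure D →ᵇ ℝ := BoundedContinuousFunction.mkOfCompact
    ⟨fun x => h x, continuousOn_iff_continuous_domRestrict.1 hh⟩
  let f : closure D →ᵇ ℝ := e.inv h'
  have hf : f - κ • T f = h' := by
    have h1 : (e.val * e.inv) h' = h' := by rw [e.val_inv]; rfl
    rw [he] at h1
    exact h1
  refine ⟨Function.extend Subtype.val f 0, continuousOn_extend_val f.continuous, fun x hx => ?_⟩
  have := congrArg (fun g : closure D →ᵇ ℝ => g ⟨x, hx⟩) hf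
  rw [extend_val_apply f hx, ← hT f ⟨x, hx⟩]
  exact this

end Fredholm

/-! ### The gradient of the fundamental solution -/

section Gradient

open Filter Topology

theorem hasFDerivAt_inv_norm_pow {V : Type*} [NormedAddCommGroup V] [InnerProductSpace ℝ V]
    (n : ℕ) {z : V} (hz : z ≠ 0) :
    HasFDerivAt (fun z : V => (‖z‖ ^ n)⁻¹) ((-(n : ℝ) * (‖z‖ ^ (n + 2))⁻¹) • innerSL ℝ z) z := by
  have hz' : ‖z‖ ≠ 0 := norm_ne_zero_iff.2 hz
  have h1 : HasFDerivAt (fun z : V => ‖z‖) (‖z‖⁻¹ • innerSL ℝ z) z := by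
    have := (hasStrictFDerivAt_norm_sq z).hasFDerivAt.sqrt (pow_ne_zero 2 hz')
    simp only [Real.sqrt_sq (norm_nonneg _)] at this
    refine this.congr_fderiv ?_
    ext v
    simp
    field_simp
  have h2 : HasDerivAt (fun r : ℝ => (r ^ n)⁻¹) (-(n : ℝ) * (‖z‖ ^ (n + 1))⁻¹) ‖z‖ := by
    refine ((hasDerivAt_pow n ‖z‖).inv (pow_ne_zero n hz')).congr_deriv ?_
    rcases n with _ | n
    · simp
    · simp only [Nat.add_sub_cancel]
      field_simp
      ring
  refine (h2.comp_hasFDerivAt z h1).congr_fderiv ?_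
  rw [smul_smul]
  congr 1
  rw [pow_succ ‖z‖ (n + 1), mul_inv]
  ring

variable {m : ℕ}

/-- The gradient of the fundamental solution, as a family of linear forms. -/
def laplaceFundamentalGradient (z : EuclideanSpace ℝ (Fin m)) :
    EuclideanSpace ℝ (Fin m) →L[ℝ] ℝ :=
  ((unitSphereArea m)⁻¹ * (‖z‖ ^ m)⁻¹) • innerSL ℝ z

theorem laplaceFundamentalGradient_apply (z v : EuclideanSpace ℝ (Fin m)) :
    laplaceFundamentalGradient z v = (unitSphereArea m)⁻¹ * (‖z‖ ^ m)⁻¹ * ⟪z, v⟫ := by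
  simp [laplaceFundamentalGradient]

theorem hasFDerivAt_laplaceFundamentalSolution (hm : 3 ≤ m) {z : EuclideanSpace ℝ (Fin m)}
    (hz : z ≠ 0) : HasFDerivAt laplaceFundamentalSolution (laplaceFundamentalGradient z) z := by
  have h := (hasFDerivAt_inv_norm_pow (m - 2) hz).const_mul
    (((2 - (m : ℝ)) * unitSphereArea m)⁻¹)
  rw [funext laplaceFundamentalSolution_eq]
  refine h.congr_fderiv ?_
  rw [laplaceFundamentalGradient, smul_smul, Nat.sub_add_cancel (by omega),
    Nat.cast_sub (by omega)]
  congr 1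
  have h3 : (3 : ℝ) ≤ m := by exact_mod_cast hm
  have h2 : (2 : ℝ) - m ≠ 0 := by linarith
  rw [mul_inv]
  push_cast
  field_simp
  ring

theorem contDiffAt_laplaceFundamentalSolution {z : EuclideanSpace ℝ (Fin m)} (hz : z ≠ 0)
    {n : WithTop ℕ∞} : ContDiffAt ℝ n laplaceFundamentalSolution z := by
  rw [funext laplaceFundamentalSolution_eq]
  exact contDiffAt_const.mul (((contDiffAt_norm ℝ hz).pow _).inv
    (pow_ne_zero _ (norm_ne_zero_iff.2 hz)))

theorem continuousAt_laplaceFundamentalGradient {z : EuclideanSpace ℝ (Fin m)} (hz : z ≠ 0) :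
    ContinuousAt laplaceFundamentalGradient z := by
  have h1 : ContinuousAt (fun z : EuclideanSpace ℝ (Fin m) =>
      (unitSphereArea m)⁻¹ * (‖z‖ ^ m)⁻¹) z :=
    continuousAt_const.mul ((continuous_norm.pow m).continuousAt.inv₀
      (pow_ne_zero _ (norm_ne_zero_iff.2 hz)))
  exact h1.smul (innerSL (E := EuclideanSpace ℝ (Fin m)) ℝ).continuous.continuousAt

/-- The norm of the gradient is `ω_m⁻¹ |z|^(1-m)`; at the pole both expressions are `0`. -/
theorem locallyIntegrable_laplaceFundamentalGradient (hm : 3 ≤ m) :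
    LocallyIntegrable (laplaceFundamentalGradient (m := m)) := by
  have hω := unitSphereArea_pos (m := m) (by omega)
  refine LocallyIntegrable.mono ((locallyIntegrable_inv_norm_pow (m := m) (k := m - 1)
    (by omega)).smul (unitSphereArea m)⁻¹) ?_ (Eventually.of_forall fun z => ?_)
  · exact ((measurable_inv_norm_pow m).const_mul _).aestronglyMeasurable.smul
      (innerSL (E := EuclideanSpace ℝ (Fin m)) ℝ).continuous.aestronglyMeasurable
  · rw [laplaceFundamentalGradient, norm_smul, innerSL_apply_norm, Pi.smul_apply, smul_eq_mul,
      norm_mul, norm_mul, mul_assoc]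
    refine le_of_eq ?_
    congr 1
    rw [Real.norm_of_nonneg (by positivity), Real.norm_of_nonneg (by positivity)]
    have hp : ‖z‖ ^ m = ‖z‖ ^ (m - 1) * ‖z‖ := by
      rw [← pow_succ, Nat.sub_add_cancel (by omega)]
    rcases eq_or_ne ‖z‖ 0 with h0 | h0
    · rw [h0, zero_pow (by omega : m - 1 ≠ 0)]; simp
    · rw [hp]
      field_simp

/-- The trace of a bilinear form on Euclidean space. -/
def bilinTrace (m : ℕ) :
    (EuclideanSpace ℝ (Fin m) →L[ℝ] EuclideanSpace ℝ (Fin m) →L[ℝ] ℝ) →L[ℝ] ℝ :=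
  ∑ i, (ContinuousLinearMap.apply ℝ ℝ (EuclideanSpace.basisFun (Fin m) ℝ i)).comp
    (ContinuousLinearMap.apply ℝ (EuclideanSpace ℝ (Fin m) →L[ℝ] ℝ)
      (EuclideanSpace.basisFun (Fin m) ℝ i))

theorem bilinTrace_apply
    (Q : EuclideanSpace ℝ (Fin m) →L[ℝ] EuclideanSpace ℝ (Fin m) →L[ℝ] ℝ) :
    bilinTrace m Q = ∑ i, Q (EuclideanSpace.basisFun (Fin m) ℝ i)
      (EuclideanSpace.basisFun (Fin m) ℝ i) := by
  simp [bilinTrace]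

theorem laplacian_eq_bilinTrace {f : EuclideanSpace ℝ (Fin m) → ℝ}
    {P : EuclideanSpace ℝ (Fin m) → EuclideanSpace ℝ (Fin m) →L[ℝ] ℝ}
    {Q : EuclideanSpace ℝ (Fin m) →L[ℝ] EuclideanSpace ℝ (Fin m) →L[ℝ] ℝ}
    {x : EuclideanSpace ℝ (Fin m)} (hf : ∀ᶠ y in 𝓝 x, HasFDerivAt f (P y) y)
    (hP : HasFDerivAt P Q x) : Δ f x = bilinTrace m Q := by
  have h1 : fderiv ℝ f =ᶠ[𝓝 x] P := hf.mono fun y hy => hy.fderiv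
  rw [InnerProductSpace.laplacian_eq_iteratedFDeriv_orthonormalBasis f
    (EuclideanSpace.basisFun (Fin m) ℝ), bilinTrace_apply]
  simp only [iteratedFDeriv_two_apply, h1.fderiv_eq, hP.fderiv]
  rfl

/-- Harmonicity of `E` off the pole: the trace is `ω_m⁻¹ (m |z|^(-m) - m |z|^(-m-2) |z|²) = 0`. -/
theorem exists_hasFDerivAt_laplaceFundamentalGradient {z : EuclideanSpace ℝ (Fin m)}
    (hz : z ≠ 0) : ∃ Q, HasFDerivAt laplaceFundamentalGradient Q z ∧ bilinTrace m Q = 0 := by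
  let J : EuclideanSpace ℝ (Fin m) →L[ℝ] EuclideanSpace ℝ (Fin m) →L[ℝ] ℝ := innerSL ℝ
  have hJ : ∀ v w, J v w = ⟪v, w⟫ := fun v w => rfl
  have h := ((hasFDerivAt_inv_norm_pow m hz).const_mul (unitSphereArea m)⁻¹).smul
    (J.hasFDerivAt (x := z))
  refine ⟨_, h, ?_⟩
  rw [bilinTrace_apply]
  have hz' : ‖z‖ ≠ 0 := norm_ne_zero_iff.2 hz
  have e := (EuclideanSpace.basisFun (Fin m) ℝ).sum_sq_inner_left z
  have e2 : ∀ i, (((unitSphereArea m)⁻¹ * (‖z‖ ^ m)⁻¹) • J +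
      ((unitSphereArea m)⁻¹ • (-(m : ℝ) * (‖z‖ ^ (m + 2))⁻¹) • innerSL ℝ z).smulRight
        (J z)) (EuclideanSpace.basisFun (Fin m) ℝ i) (EuclideanSpace.basisFun (Fin m) ℝ i)
      = (unitSphereArea m)⁻¹ * (‖z‖ ^ m)⁻¹ - (unitSphereArea m)⁻¹ * m * (‖z‖ ^ (m + 2))⁻¹ *
        ⟪z, EuclideanSpace.basisFun (Fin m) ℝ i⟫ ^ 2 := by
    intro i
    have h1 := (EuclideanSpace.basisFun (Fin m) ℝ).inner_eq_one i
    simp only [add_apply, smul_apply, innerSL_apply_apply, hJ,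
      ContinuousLinearMap.smulRight_apply, smul_eq_mul]
    rw [h1]
    ring
  rw [Finset.sum_congr rfl fun i _ => e2 i, Finset.sum_sub_distrib,
    ← Finset.mul_sum (s := Finset.univ)
    (f := fun i => ⟪z, EuclideanSpace.basisFun (Fin m) ℝ i⟫ ^ 2), e]
  simp only [Finset.sum_const, Finset.card_univ, Fintype.card_fin, nsmul_eq_mul, pow_add]
  field_simp
  ring

end Gradient

/-! ### Polar coordinates -/

section Polar

open Measure Filter Topology

variable {m : ℕ}

theorem integral_eq_integral_toSphere {V : Type*} [NormedAddCommGroup V] [NormedSpace ℝ V]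
    [FiniteDimensional ℝ V] [Nontrivial V] [MeasurableSpace V] [BorelSpace V] (μ : Measure V)
    [μ.IsAddHaarMeasure] {G : V → ℝ} (hG : Integrable G μ) :
    ∫ z, G z ∂μ = ∫ θ : Metric.sphere (0 : V) 1,
      (∫ r in Ioi (0 : ℝ), r ^ (Module.finrank ℝ V - 1) * G (r • (θ : V))) ∂μ.toSphere := by
  have hmp := μ.measurePreserving_homeomorphUnitSphereProd
  have hemb := (homeomorphUnitSphereProd V).measurableEmbedding
  set H : Metric.sphere (0 : V) 1 × Ioi (0 : ℝ) → ℝ := fun p => G (p.2.1 • (p.1 : V))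
  have hH : ∀ x : ({(0)}ᶜ : Set V), H (homeomorphUnitSphereProd V x) = G x := fun x => by
    have hx : ‖(x : V)‖ ≠ 0 := norm_ne_zero_iff.2 x.2
    simp only [H, homeomorphUnitSphereProd_apply_fst_coe, homeomorphUnitSphereProd_apply_snd_coe,
      smul_smul, mul_inv_cancel₀ hx, one_smul]
  have hHi : Integrable H (μ.toSphere.prod (.volumeIoiPow (Module.finrank ℝ V - 1))) := by
    rw [← hmp.integrable_comp_emb hemb]
    have : H ∘ homeomorphUnitSphereProd V = G ∘ (↑) := funext hH
    rw [this, ← integrableOn_iff_comap_subtypeVal (measurableSet_singleton _).compl]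
    exact hG.integrableOn
  calc ∫ z, G z ∂μ = ∫ x : ({(0)}ᶜ : Set V), G x ∂(μ.comap (↑)) := by
        rw [integral_subtype_comap (measurableSet_singleton _).compl G, restrict_compl_singleton]
    _ = ∫ p, H p ∂μ.toSphere.prod (.volumeIoiPow (Module.finrank ℝ V - 1)) := by
        rw [← hmp.integral_comp hemb H]
        simp only [hH]
    _ = ∫ θ, ∫ r, H (θ, r) ∂(.volumeIoiPow (Module.finrank ℝ V - 1)) ∂μ.toSphere :=
        integral_prod _ hHi
    _ = _ := by
        congr 1
        ext θ
        simp only [Measure.volumeIoiPow, ENNReal.ofReal]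
        rw [integral_withDensity_eq_integral_smul,
          integral_subtype_comap measurableSet_Ioi fun r : ℝ =>
            Real.toNNReal (r ^ (Module.finrank ℝ V - 1)) • G (r • (θ : V)),
          setIntegral_congr_fun measurableSet_Ioi fun r hr => ?_]
        · rw [NNReal.smul_def, Real.coe_toNNReal _ (pow_nonneg hr.out.le _), smul_eq_mul]
        · exact (measurable_subtype_coe.pow_const _).real_toNNReal

theorem toSphere_real_univ_eq_unitSphereArea (hm : 0 < m) :
    (volume : Measure (EuclideanSpace ℝ (Fin m))).toSphere.real univ = unitSphereArea m := by
  have : Nonempty (Fin m) := ⟨⟨0, hm⟩⟩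
  have hm' : (0 : ℝ) < m := by exact_mod_cast hm
  have hG := Real.Gamma_pos_of_pos (s := (m : ℝ) / 2) (by positivity)
  rw [toSphere_real_apply_univ, measureReal_def, EuclideanSpace.volume_ball,
    finrank_euclideanSpace_fin, Fintype.card_fin, unitSphereArea,
    Real.Gamma_add_one (by positivity), Real.sqrt_eq_rpow, ← Real.rpow_natCast,
    ← Real.rpow_mul Real.pi_pos.le]
  simp only [ENNReal.ofReal_one, one_pow, one_mul]
  rw [ENNReal.toReal_ofReal (by positivity), one_div, inv_mul_eq_div]
  field_simp

/-- `∇E` inverts the negative divergence: integration by parts in polar coordinates. -/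
theorem integral_laplaceFundamentalGradient_fderiv (hm : 3 ≤ m)
    {φ : EuclideanSpace ℝ (Fin m) → ℝ} (hφ : ContDiff ℝ 1 φ) (hc : HasCompactSupport φ)
    (hint : Integrable fun z => (unitSphereArea m)⁻¹ * (‖z‖ ^ m)⁻¹ * fderiv ℝ φ z z) :
    ∫ z, (unitSphereArea m)⁻¹ * (‖z‖ ^ m)⁻¹ * fderiv ℝ φ z z = - φ 0 := by
  have hfr : Module.finrank ℝ (EuclideanSpace ℝ (Fin m)) = m := finrank_euclideanSpace_fin
  have : Nontrivial (EuclideanSpace ℝ (Fin m)) := Module.nontrivial_of_finrank_pos (R := ℝ)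
    (by rw [hfr]; omega)
  have hω := unitSphereArea_pos (m := m) (by omega)
  rw [integral_eq_integral_toSphere volume hint, hfr]
  have hinner : ∀ θ : Metric.sphere (0 : EuclideanSpace ℝ (Fin m)) 1,
      ∫ r in Ioi (0 : ℝ), r ^ (m - 1) * ((unitSphereArea m)⁻¹ *
        (‖r • (θ : EuclideanSpace ℝ (Fin m))‖ ^ m)⁻¹ *
        fderiv ℝ φ (r • (θ : EuclideanSpace ℝ (Fin m))) (r • (θ : EuclideanSpace ℝ (Fin m)))) =
      - ((unitSphereArea m)⁻¹ * φ 0) := by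
    intro θ
    have hθ : ‖(θ : EuclideanSpace ℝ (Fin m))‖ = 1 := by simp
    have hd : ∀ r : ℝ, HasDerivAt (fun r : ℝ => φ (r • (θ : EuclideanSpace ℝ (Fin m))))
        (fderiv ℝ φ (r • (θ : EuclideanSpace ℝ (Fin m))) θ) r := fun r => by
      have h1 : HasDerivAt (fun r : ℝ => r • (θ : EuclideanSpace ℝ (Fin m))) θ r := by
        simpa using (hasDerivAt_id r).smul_const (θ : EuclideanSpace ℝ (Fin m))
      exact ((hφ.differentiable one_ne_zero) _).hasFDerivAt.comp_hasDerivAt r h1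
    have hcl : IsClosedEmbedding fun r : ℝ => r • (θ : EuclideanSpace ℝ (Fin m)) := by
      refine Isometry.isClosedEmbedding (Isometry.of_dist_eq fun r s => ?_)
      rw [dist_eq_norm, ← sub_smul, norm_smul, hθ, mul_one, dist_eq_norm]
    have hψ : HasCompactSupport fun r : ℝ => φ (r • (θ : EuclideanSpace ℝ (Fin m))) :=
      hc.comp_isClosedEmbedding hcl
    have hψ' : HasCompactSupport fun r : ℝ =>
        fderiv ℝ φ (r • (θ : EuclideanSpace ℝ (Fin m))) θ := by
      exact ((hc.fderiv ℝ).comp_isClosedEmbedding hcl).comp_left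
        (g := fun L : EuclideanSpace ℝ (Fin m) →L[ℝ] ℝ => L θ) (by simp)
    have hψc : Continuous fun r : ℝ => fderiv ℝ φ (r • (θ : EuclideanSpace ℝ (Fin m))) θ :=
      ((hφ.continuous_fderiv one_ne_zero).comp hcl.continuous).clm_apply continuous_const
    have hftc := integral_Ioi_of_hasDerivAt_of_tendsto (a := (0 : ℝ)) (m := (0 : ℝ))
      (hd 0).continuousAt.continuousWithinAt (fun r _ => hd r)
      (hψc.integrable_of_hasCompactSupport hψ').integrableOn
      (hψ.is_zero_at_infty.mono_left atTop_le_cocompact)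
    rw [zero_smul, zero_sub] at hftc
    rw [← mul_neg, ← hftc, ← integral_const_mul]
    refine setIntegral_congr_fun measurableSet_Ioi fun r hr => ?_
    have hr : (0 : ℝ) < r := hr
    simp only [map_smul, norm_smul, hθ, mul_one, Real.norm_of_nonneg hr.le, smul_eq_mul]
    -- The Jacobian `r^(m-1)`, the kernel `r^(-m)` and the factor `r` from `fderiv` at `r • θ`
    -- cancel, leaving the radial derivative of `φ`.
    obtain ⟨k, rfl⟩ : ∃ k, m = k + 1 := ⟨m - 1, by omega⟩
    rw [Nat.add_sub_cancel]
    field_simp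
    ring
  simp only [hinner]
  rw [integral_const, toSphere_real_univ_eq_unitSphereArea (by omega), smul_eq_mul]
  field_simp

end Polar

/-! ### Newtonian potentials of regular compactly supported densities -/

section Potential

open Filter Topology ContinuousLinearMap
open scoped Convolution

/-- A function whose increments are the integrals of a continuous field of linear forms along
segments is differentiable. -/
theorem hasFDerivAt_of_sub_eq_integral_segment {V : Type*} [NormedAddCommGroup V]
    [NormedSpace ℝ V] {f : V → ℝ} {G : V → V →L[ℝ] ℝ} (hG : Continuous G)
    (h : ∀ x v, f (x + v) - f x = ∫ s in (0 : ℝ)..1, G (x + s • v) v) (x : V) :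
    HasFDerivAt f (G x) x := by
  rw [hasFDerivAt_iff_isLittleO_nhds_zero, Asymptotics.isLittleO_iff]
  intro ε hε
  obtain ⟨δ, hδ, hδG⟩ := Metric.continuousAt_iff.1 (hG.continuousAt (x := x)) ε hε
  filter_upwards [Metric.ball_mem_nhds (0 : V) hδ] with v hv
  have hv : ‖v‖ < δ := by simpa using hv
  have hci : Continuous fun s : ℝ => G (x + s • v) v :=
    (hG.comp (by fun_prop)).clm_apply continuous_const
  have e : f (x + v) - f x - G x v = ∫ s in (0 : ℝ)..1, (G (x + s • v) v - G x v) := by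
    rw [h, intervalIntegral.integral_sub (hci.intervalIntegrable _ _)
      (continuous_const.intervalIntegrable _ _)]
    simp
  rw [e]
  refine (intervalIntegral.norm_integral_le_of_norm_le_const (C := ε * ‖v‖) fun s hs => ?_).trans
    (by simp)
  rw [uIoc_of_le zero_le_one] at hs
  rw [← sub_apply]
  refine (le_opNorm _ _).trans ?_
  gcongr
  have : dist (x + s • v) x < δ := by
    rw [dist_self_add_left, norm_smul, Real.norm_of_nonneg hs.1.le]
    exact (mul_le_of_le_one_left (norm_nonneg _) hs.2).trans_lt hv
  rw [← dist_eq_norm]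
  exact (hδG this).le

variable {m : ℕ}

theorem laplaceFundamentalSolution_add_sub_eq_integral (hm : 3 ≤ m)
    {y v : EuclideanSpace ℝ (Fin m)} (h : ∀ s : ℝ, y + s • v ≠ 0) :
    laplaceFundamentalSolution (y + v) - laplaceFundamentalSolution y =
      ∫ s in (0 : ℝ)..1, laplaceFundamentalGradient (y + s • v) v := by
  have hc : Continuous fun s : ℝ => laplaceFundamentalGradient (y + s • v) v := by
    refine continuous_iff_continuousAt.2 fun s => ?_
    have h1 : ContinuousAt (fun s : ℝ => y + s • v) s := by fun_prop
    exact (ContinuousAt.comp (f := fun s : ℝ => y + s • v)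
      (continuousAt_laplaceFundamentalGradient (h s)) h1).clm_apply continuousAt_const
  rw [intervalIntegral.integral_eq_sub_of_hasDerivAt
    (f := fun s : ℝ => laplaceFundamentalSolution (y + s • v)) (fun s _ => ?_)
    (hc.intervalIntegrable _ _)]
  · simp
  · have h1 : HasDerivAt (fun s : ℝ => y + s • v) v s := by
      simpa using ((hasDerivAt_id s).smul_const v).const_add y
    exact (hasFDerivAt_laplaceFundamentalSolution hm (h s)).comp_hasDerivAt s h1

/-- The exceptional `t` lie on a translate of the line spanned by `v`, a null set. For all other `t`
the fundamental theorem of calculus applies along the segment, away from the pole. -/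
theorem ae_forall_sub_add_smul_ne_zero (hm : 2 ≤ m) (x v : EuclideanSpace ℝ (Fin m)) :
    ∀ᵐ t, ∀ s : ℝ, x - t + s • v ≠ 0 := by
  have hspan : (ℝ ∙ v) ≠ ⊤ := by
    intro htop
    have h1 := finrank_span_le_card (R := ℝ) ({v} : Set (EuclideanSpace ℝ (Fin m)))
    rw [htop, finrank_top, finrank_euclideanSpace_fin, toFinset_singleton,
      Finset.card_singleton] at h1
    omega
  have h0 := Measure.addHaar_submodule volume (ℝ ∙ v) hspan
  have h1 : volume ((fun t => t + -x) ⁻¹' ((ℝ ∙ v : Submodule ℝ _) :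
      Set (EuclideanSpace ℝ (Fin m)))) = 0 := by
    rw [measure_preimage_add_right, h0]
  filter_upwards [compl_mem_ae_iff.2 h1] with t ht s hs
  refine ht (Submodule.mem_span_singleton.2 ⟨s, ?_⟩)
  change s • v = t + -x
  rw [← sub_eq_add_neg, eq_sub_iff_add_eq]
  rw [sub_add_eq_add_sub, sub_eq_zero] at hs
  rw [add_comm, hs]

/-- The potential `g ⋆ E` of a density with compact support. -/
def convPotential (g : EuclideanSpace ℝ (Fin m) → ℝ) : EuclideanSpace ℝ (Fin m) → ℝ :=
  g ⋆[lsmul ℝ ℝ, volume] laplaceFundamentalSolution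

/-- The gradient `g ⋆ ∇E` of the potential `g ⋆ E`. -/
def convGradient (g : EuclideanSpace ℝ (Fin m) → ℝ) :
    EuclideanSpace ℝ (Fin m) → EuclideanSpace ℝ (Fin m) →L[ℝ] ℝ :=
  g ⋆[lsmul ℝ ℝ, volume] laplaceFundamentalGradient

variable {g : EuclideanSpace ℝ (Fin m) → ℝ}

theorem continuous_convGradient (hm : 3 ≤ m) (hg : Continuous g) (hgc : HasCompactSupport g) :
    Continuous (convGradient g) :=
  hgc.continuous_convolution_left _ hg (locallyIntegrable_laplaceFundamentalGradient hm)

/-- Avoids differentiating a singular kernel under the integral sign: increments of `E` are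
integrated along segments for almost every `t`, and Fubini swaps the integrals. -/
theorem convPotential_sub_eq_integral (hm : 3 ≤ m) (hg : Continuous g)
    (hgc : HasCompactSupport g) (x v : EuclideanSpace ℝ (Fin m)) :
    convPotential g (x + v) - convPotential g x =
      ∫ s in (0 : ℝ)..1, convGradient g (x + s • v) v := by
  have hE := hgc.convolutionExists_left (lsmul ℝ ℝ) hg
    (locallyIntegrable_laplaceFundamentalSolution hm)
  have hF := hgc.convolutionExists_left (lsmul ℝ ℝ) hg
    (locallyIntegrable_laplaceFundamentalGradient hm)
  have hFmeas : Measurable fun z : EuclideanSpace ℝ (Fin m) => laplaceFundamentalGradient z v := by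
    simp only [laplaceFundamentalGradient_apply]
    exact ((measurable_inv_norm_pow m).const_mul _).mul
      (continuous_id.inner continuous_const).measurable
  have hFv : LocallyIntegrable fun z : EuclideanSpace ℝ (Fin m) =>
      ‖laplaceFundamentalGradient z v‖ := by
    refine ((locallyIntegrable_laplaceFundamentalGradient hm).smul ‖v‖).mono
      hFmeas.norm.aestronglyMeasurable (Eventually.of_forall fun z => ?_)
    rw [Pi.smul_apply, norm_smul, norm_norm, norm_norm, mul_comm]
    exact le_opNorm _ _
  have hcont : Continuous ((fun t => ‖g t‖) ⋆[lsmul ℝ ℝ, volume]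
      fun z : EuclideanSpace ℝ (Fin m) => ‖laplaceFundamentalGradient z v‖) :=
    hgc.norm.continuous_convolution_left _ hg.norm hFv
  have hint : Integrable (Function.uncurry fun (t : EuclideanSpace ℝ (Fin m)) (s : ℝ) =>
      g t * laplaceFundamentalGradient (x + s • v - t) v)
      (volume.prod (volume.restrict (Ioc (0 : ℝ) 1))) := by
    have hmeas : AEStronglyMeasurable
        (Function.uncurry fun (t : EuclideanSpace ℝ (Fin m)) (s : ℝ) =>
        g t * laplaceFundamentalGradient (x + s • v - t) v)
        (volume.prod (volume.restrict (Ioc (0 : ℝ) 1))) := by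
      refine Measurable.aestronglyMeasurable ?_
      refine (hg.measurable.comp measurable_fst).mul (hFmeas.comp ?_)
      fun_prop
    refine (integrable_prod_iff' hmeas).2 ⟨Eventually.of_forall fun s => ?_, ?_⟩
    · exact (apply ℝ ℝ v).integrable_comp (hF (x + s • v))
    -- The `L¹` norm in `t` is a convolution evaluated at `x + s • v`, hence continuous and
    -- integrable in `s`.
    · have h1 : Continuous fun s : ℝ => ((fun t => ‖g t‖) ⋆[lsmul ℝ ℝ, volume]
        fun z : EuclideanSpace ℝ (Fin m) => ‖laplaceFundamentalGradient z v‖) (x + s • v) :=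
        hcont.comp (by fun_prop)
      refine (h1.integrableOn_Icc.mono_set Ioc_subset_Icc_self).congr
        (Eventually.of_forall fun s => ?_)
      simp [convolution_def]
  calc convPotential g (x + v) - convPotential g x
      = ∫ t, (g t * laplaceFundamentalSolution (x + v - t) -
          g t * laplaceFundamentalSolution (x - t)) :=
        (integral_sub (hE (x + v)) (hE x)).symm
    _ = ∫ t, ∫ s in Ioc (0 : ℝ) 1, g t * laplaceFundamentalGradient (x + s • v - t) v := by
        refine integral_congr_ae ?_
        filter_upwards [ae_forall_sub_add_smul_ne_zero (by omega) x v] with t ht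
        have h1 := laplaceFundamentalSolution_add_sub_eq_integral hm ht
        rw [intervalIntegral.integral_of_le zero_le_one] at h1
        simp only [sub_add_eq_add_sub] at h1
        rw [← mul_sub, h1, integral_const_mul]
    _ = ∫ s in Ioc (0 : ℝ) 1, ∫ t, g t * laplaceFundamentalGradient (x + s • v - t) v :=
        integral_integral_swap hint
    _ = _ := by
        rw [intervalIntegral.integral_of_le zero_le_one]
        congr 1
        ext s
        exact (apply ℝ ℝ v).integral_comp_comm (hF (x + s • v))

theorem hasFDerivAt_convPotential (hm : 3 ≤ m) (hg : Continuous g) (hgc : HasCompactSupport g)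
    (x : EuclideanSpace ℝ (Fin m)) : HasFDerivAt (convPotential g) (convGradient g x) x :=
  hasFDerivAt_of_sub_eq_integral_segment (continuous_convGradient hm hg hgc)
    (convPotential_sub_eq_integral hm hg hgc) x

/-- The Newtonian potential gains one derivative. -/
theorem contDiff_convPotential (hm : 3 ≤ m) {n : ℕ} (hg : ContDiff ℝ n g)
    (hgc : HasCompactSupport g) : ContDiff ℝ (n + 1) (convPotential g) := by
  have hd := hasFDerivAt_convPotential hm hg.continuous hgc
  refine contDiff_succ_iff_fderiv.2 ⟨fun x => (hd x).differentiableAt, by simp, ?_⟩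
  rw [funext fun x => (hd x).fderiv]
  exact hgc.contDiff_convolution_left (n := (n : ℕ∞)) _ hg
    (locallyIntegrable_laplaceFundamentalGradient hm)

/-- Poisson's equation for the potential of a compactly supported `C¹` density. -/
theorem laplacian_convPotential (hm : 3 ≤ m) (hg : ContDiff ℝ 1 g) (hgc : HasCompactSupport g)
    (x : EuclideanSpace ℝ (Fin m)) : Δ (convPotential g) x = g x := by
  have hF := locallyIntegrable_laplaceFundamentalGradient hm
  let L : ℝ →L[ℝ] (EuclideanSpace ℝ (Fin m) →L[ℝ] ℝ) →L[ℝ] (EuclideanSpace ℝ (Fin m) →L[ℝ] ℝ) :=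
    lsmul ℝ ℝ
  have hL : ∀ a f, L a f = a • f := fun a f => rfl
  -- The second derivative falls on `g`, since the second derivatives of `E` are not locally
  -- integrable.
  have hQ : HasFDerivAt (convGradient g) _ x :=
    hgc.hasFDerivAt_convolution_left L hg hF x
  rw [laplacian_eq_bilinTrace
    (Eventually.of_forall (hasFDerivAt_convPotential hm hg.continuous hgc)) hQ]
  have hex := (hgc.fderiv ℝ).convolutionExists_left (𝕜 := ℝ)
    (F := EuclideanSpace ℝ (Fin m) →L[ℝ] EuclideanSpace ℝ (Fin m) →L[ℝ] ℝ)
    (L.precompL (EuclideanSpace ℝ (Fin m))) (hg.continuous_fderiv one_ne_zero) hF x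
  have htr : ∀ t, bilinTrace m (L.precompL (EuclideanSpace ℝ (Fin m)) (fderiv ℝ g t)
      (laplaceFundamentalGradient (x - t))) =
      (unitSphereArea m)⁻¹ * (‖x - t‖ ^ m)⁻¹ * fderiv ℝ g t (x - t) := fun t => by
    rw [bilinTrace_apply]
    simp only [precompL_apply, hL, smul_apply, laplaceFundamentalGradient_apply,
      smul_eq_mul]
    have h1 := (EuclideanSpace.basisFun (Fin m) ℝ).sum_repr' (x - t)
    have h2 : fderiv ℝ g t (x - t) = ∑ i, ⟪EuclideanSpace.basisFun (Fin m) ℝ i, x - t⟫ *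
        fderiv ℝ g t (EuclideanSpace.basisFun (Fin m) ℝ i) := by
      conv_lhs => rw [← h1]
      simp only [map_sum, map_smul, smul_eq_mul]
    rw [h2, Finset.mul_sum]
    refine Finset.sum_congr rfl fun i _ => ?_
    rw [real_inner_comm]
    ring
  have hi := ContinuousLinearMap.integrable_comp (𝕜 := ℝ) (𝕜' := ℝ)
    (H := EuclideanSpace ℝ (Fin m) →L[ℝ] EuclideanSpace ℝ (Fin m) →L[ℝ] ℝ) (bilinTrace m) hex
  refine (ContinuousLinearMap.integral_comp_comm (𝕜 := ℝ)
    (E := EuclideanSpace ℝ (Fin m) →L[ℝ] EuclideanSpace ℝ (Fin m) →L[ℝ] ℝ)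
    (bilinTrace m) hex).symm.trans ?_
  simp only [htr] at hi ⊢
  -- Substituting `z = x - t` recentres the pole at `0`; the reflection contributes a sign that
  -- cancels the one in `- φ 0`, and `φ 0 = g x`.
  set φ : EuclideanSpace ℝ (Fin m) → ℝ := fun z => g (x - z)
  have hφ : ContDiff ℝ 1 φ := hg.comp (contDiff_const.sub contDiff_id)
  have hφc : HasCompactSupport φ := hgc.comp_homeomorph (Homeomorph.subLeft x)
  have hφd : ∀ z, fderiv ℝ φ z = - fderiv ℝ g (x - z) := fun z => by
    have := ((hg.differentiable one_ne_zero) (x - z)).hasFDerivAt.comp z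
      ((hasFDerivAt_id z).const_sub x)
    refine this.fderiv.trans ?_
    ext v
    simp
  have hsub : ∀ t, (unitSphereArea m)⁻¹ * (‖x - t‖ ^ m)⁻¹ * fderiv ℝ g t (x - t) =
      -(fun z => (unitSphereArea m)⁻¹ * (‖z‖ ^ m)⁻¹ * fderiv ℝ φ z z) (x - t) := fun t => by
    simp only [hφd, sub_sub_cancel, neg_apply]
    ring
  simp only [hsub] at hi ⊢
  rw [integral_neg, integral_sub_left_eq_self
    (fun z => (unitSphereArea m)⁻¹ * (‖z‖ ^ m)⁻¹ * fderiv ℝ φ z z),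
    integral_laplaceFundamentalGradient_fderiv hm hφ hφc]
  · simp [φ]
  · have := (hi.neg.comp_sub_left x)
    simpa using this

end Potential

/-! ### Interior regularity of Newtonian potentials -/

section Interior

open Filter Topology ContinuousLinearMap
open scoped Convolution

variable {m : ℕ}

/-- Cutting off the fundamental solution near the pole and near infinity. -/
theorem exists_contDiff_eq_laplaceFundamentalSolution {a b : ℝ} (ha : 0 < a) (hb : 0 < b) :
    ∃ k : EuclideanSpace ℝ (Fin m) → ℝ, ContDiff ℝ 2 k ∧ HasCompactSupport k ∧
      ∀ z, a < ‖z‖ → ‖z‖ < b → k z = laplaceFundamentalSolution z := by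
  -- `1 - χ₁` vanishes near the pole and is `1` from radius `a` on; `χ₂` is `1` up to radius `b` and
  -- supplies compact support.
  let χ₁ : ContDiffBump (0 : EuclideanSpace ℝ (Fin m)) :=
    ⟨a / 2, a, by positivity, by linarith⟩
  let χ₂ : ContDiffBump (0 : EuclideanSpace ℝ (Fin m)) :=
    ⟨b, b + 1, hb, by linarith⟩
  refine ⟨fun z => χ₂ z * ((1 - χ₁ z) * laplaceFundamentalSolution z), ?_, ?_, fun z hz hz' => ?_⟩
  · refine χ₂.contDiff.mul (contDiff_iff_contDiffAt.2 fun z => ?_)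
    rcases eq_or_ne z 0 with rfl | hz
    · refine (contDiffAt_const (c := (0 : ℝ))).congr_of_eventuallyEq ?_
      filter_upwards [χ₁.eventuallyEq_one] with y hy
      rw [hy]; simp
    · exact (contDiffAt_const.sub χ₁.contDiffAt).mul (contDiffAt_laplaceFundamentalSolution hz)
  · exact χ₂.hasCompactSupport.mul_right
  · have h1 : χ₁ z = 0 := χ₁.zero_of_le_dist (by simpa [χ₁] using hz.le)
    have h2 : χ₂ z = 1 := χ₂.one_of_mem_closedBall (by simpa [χ₂] using hz'.le)
    simp only [h1, h2]
    ring

/-- Here the density is rough and the kernel smooth, so both derivatives go to `k`. -/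
theorem laplacian_convolution {f k : EuclideanSpace ℝ (Fin m) → ℝ} (hf : LocallyIntegrable f)
    (hk : ContDiff ℝ 2 k) (hkc : HasCompactSupport k) (x : EuclideanSpace ℝ (Fin m)) :
    Δ (f ⋆[lsmul ℝ ℝ, volume] k) x =
      ∫ t, f t * bilinTrace m (fderiv ℝ (fderiv ℝ k) (x - t)) := by
  let L : ℝ →L[ℝ] ℝ →L[ℝ] ℝ := lsmul ℝ ℝ
  have hk' : ContDiff ℝ 1 (fderiv ℝ k) := hk.fderiv_right (by norm_num)
  have hd1 := hkc.hasFDerivAt_convolution_right (μ := volume) L hf (hk.of_le (by norm_num))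
  have hd2 := (hkc.fderiv ℝ).hasFDerivAt_convolution_right (μ := volume)
    (L.precompR (EuclideanSpace ℝ (Fin m))) hf hk' x
  rw [laplacian_eq_bilinTrace (Eventually.of_forall hd1) hd2]
  have hk2c : HasCompactSupport (fderiv ℝ (fderiv ℝ k)) := (hkc.fderiv ℝ).fderiv ℝ
  have hk2 : Continuous (fderiv ℝ (fderiv ℝ k)) := hk'.continuous_fderiv one_ne_zero
  have hcomp : ∀ v : EuclideanSpace ℝ (Fin m),
      HasCompactSupport fun z => fderiv ℝ (fderiv ℝ k) z v :=
    fun v => hk2c.comp_left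
      (g := fun Q : EuclideanSpace ℝ (Fin m) →L[ℝ] EuclideanSpace ℝ (Fin m) →L[ℝ] ℝ => Q v) rfl
  have hcont : ∀ v : EuclideanSpace ℝ (Fin m), Continuous fun z => fderiv ℝ (fderiv ℝ k) z v :=
    fun v => hk2.clm_apply continuous_const
  have hint : ∀ v : EuclideanSpace ℝ (Fin m),
      Integrable fun t => f t * fderiv ℝ (fderiv ℝ k) (x - t) v v := fun v =>
    ((hcomp v).comp_left (g := fun l : EuclideanSpace ℝ (Fin m) →L[ℝ] ℝ => l v)
      rfl).convolutionExists_right (μ := volume) L hf ((hcont v).clm_apply continuous_const) x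
  simp only [bilinTrace_apply, Finset.mul_sum]
  rw [integral_finsetSum _ fun i _ => hint _]
  refine Finset.sum_congr rfl fun i _ => ?_
  rw [convolution_precompR_apply _ hf hk2c hk2, convolution_precompR_apply _ hf (hcomp _) (hcont _)]
  rfl

/-- Potentials are harmonic away from the support of the density. -/
theorem harmonic_potential_of_eq_zero_near (hm : 3 ≤ m) {f : EuclideanSpace ℝ (Fin m) → ℝ}
    (hf : Integrable f) {x₀ : EuclideanSpace ℝ (Fin m)} {δ R : ℝ} (hδ : 0 < δ)
    (hnear : ∀ t, dist t x₀ < δ → f t = 0) (hfar : ∀ t, R < dist t x₀ → f t = 0) :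
    ContDiffAt ℝ 2 (fun x => ∫ t, f t * laplaceFundamentalSolution (x - t)) x₀ ∧
      (Δ (fun x => ∫ t, f t * laplaceFundamentalSolution (x - t)) :
        EuclideanSpace ℝ (Fin m) → ℝ) x₀ = 0 := by
  -- For `x` within `δ/2` of `x₀` and `f t ≠ 0`, the distance `‖x - t‖` lies strictly between `δ/2`
  -- and `R + δ/2`; the cutoff radii leave room on both sides, and `|R|` keeps the outer one
  -- positive.
  have hb : 0 < |R| + δ + 1 := by positivity
  obtain ⟨k, hk, hkc, hkE⟩ := exists_contDiff_eq_laplaceFundamentalSolution (m := m)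
    (a := δ / 4) (b := |R| + δ + 1) (by positivity) hb
  have hrange : ∀ x t, dist x x₀ < δ / 2 → f t ≠ 0 →
      δ / 4 < ‖x - t‖ ∧ ‖x - t‖ < |R| + δ + 1 := by
    intro x t hx ht
    have h1 : δ ≤ dist t x₀ := not_lt.1 fun h => ht (hnear t h)
    have h2 : dist t x₀ ≤ R := not_lt.1 fun h => ht (hfar t h)
    rw [← dist_eq_norm]
    have h3 := dist_triangle t x x₀
    have h4 := dist_triangle_right x t x₀
    rw [dist_comm t x] at h3
    have h5 := le_abs_self R
    constructor <;> linarith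
  have heq : (fun x => ∫ t, f t * laplaceFundamentalSolution (x - t)) =ᶠ[𝓝 x₀]
      (f ⋆[lsmul ℝ ℝ, volume] k) := by
    filter_upwards [Metric.ball_mem_nhds x₀ (half_pos hδ)] with x hx
    refine integral_congr_ae (Eventually.of_forall fun t => ?_)
    by_cases ht : f t = 0
    · simp [ht]
    · obtain ⟨h1, h2⟩ := hrange x t hx ht
      simp [hkE _ h1 h2]
  have hfl := hf.locallyIntegrable
  refine ⟨(hkc.contDiff_convolution_right (n := 2) (lsmul ℝ ℝ) hfl
    hk).contDiffAt.congr_of_eventuallyEq heq, ?_⟩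
  rw [InnerProductSpace.laplacian_congr_nhds heq |>.eq_of_nhds]
  rw [laplacian_convolution hfl hk hkc]
  refine integral_eq_zero_of_ae (Eventually.of_forall fun t => ?_)
  change f t * bilinTrace m (fderiv ℝ (fderiv ℝ k) (x₀ - t)) = 0
  by_cases ht : f t = 0
  · simp [ht]
  obtain ⟨h1, h2⟩ := hrange x₀ t (by simpa using half_pos hδ) ht
  have hz : x₀ - t ≠ 0 := norm_pos_iff.1 ((by positivity : (0 : ℝ) < δ / 4).trans h1)
  obtain ⟨Q, hQ, hQ0⟩ := exists_hasFDerivAt_laplaceFundamentalGradient hz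
  have hopen : IsOpen {z : EuclideanSpace ℝ (Fin m) | δ / 4 < ‖z‖ ∧ ‖z‖ < |R| + δ + 1} :=
    (isOpen_lt continuous_const continuous_norm).inter (isOpen_lt continuous_norm continuous_const)
  have hfd : fderiv ℝ k =ᶠ[𝓝 (x₀ - t)] laplaceFundamentalGradient := by
    filter_upwards [hopen.mem_nhds ⟨h1, h2⟩] with z hz
    have hz0 : z ≠ 0 := norm_pos_iff.1 ((by positivity : (0 : ℝ) < δ / 4).trans hz.1)
    have hkz : k =ᶠ[𝓝 z] laplaceFundamentalSolution := by
      filter_upwards [hopen.mem_nhds hz] with y hy using hkE y hy.1 hy.2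
    rw [hkz.fderiv_eq, (hasFDerivAt_laplaceFundamentalSolution hm hz0).fderiv]
  rw [hfd.fderiv_eq, hQ.fderiv, hQ0, mul_zero]

variable {D : Set (EuclideanSpace ℝ (Fin m))} {u : EuclideanSpace ℝ (Fin m) → ℝ}

/-- Near an interior point, a Newtonian potential is the sum of the potential of a compactly
supported density of the same regularity and a harmonic function. -/
theorem exists_newtonianPotential_eq_convPotential_add (hm : 3 ≤ m) (hD : IsOpen D)
    (hb : Bornology.IsBounded D) {B : ℝ} (hB : ∀ y ∈ D, |u y| ≤ B) {n : ℕ}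
    (hu : ContDiffOn ℝ n u D) {x₀ : EuclideanSpace ℝ (Fin m)} (hx₀ : x₀ ∈ D) :
    ∃ g w : EuclideanSpace ℝ (Fin m) → ℝ, ContDiff ℝ n g ∧ HasCompactSupport g ∧ g x₀ = u x₀ ∧
      ContDiffAt ℝ 2 w x₀ ∧ Δ w x₀ = 0 ∧ newtonianPotential D u = convPotential g + w := by
  have hvol : volume D < ⊤ := hb.measure_lt_top
  obtain ⟨ε, hε, hεD⟩ := Metric.isOpen_iff.1 hD x₀ hx₀
  -- The inner radius makes `u - g` vanish near `x₀`; the outer one keeps the support of `χ` inside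
  -- `D`.
  let χ : ContDiffBump x₀ := ⟨ε / 4, ε / 2, by positivity, by linarith⟩
  have hχD : tsupport χ ⊆ D := by
    rw [χ.tsupport_eq]
    exact (Metric.closedBall_subset_ball (by simp only [χ]; linarith)).trans hεD
  set g : EuclideanSpace ℝ (Fin m) → ℝ := fun t => χ t * u t
  have hgD : ∀ t, t ∉ D → g t = 0 := fun t ht => by
    have : χ t = 0 := image_eq_zero_of_notMem_tsupport fun h => ht (hχD h)
    simp [g, this]
  have hg : ContDiff ℝ n g := by
    refine contDiff_iff_contDiffAt.2 fun t => ?_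
    by_cases ht : t ∈ D
    · exact χ.contDiffAt.mul (hu.contDiffAt (hD.mem_nhds ht))
    · refine (contDiffAt_const (c := (0 : ℝ))).congr_of_eventuallyEq ?_
      have : t ∉ tsupport χ := fun h => ht (hχD h)
      filter_upwards [notMem_tsupport_iff_eventuallyEq.1 this] with y hy
      simp [g, hy]
  have hgc : HasCompactSupport g := χ.hasCompactSupport.mul_right
  set f : EuclideanSpace ℝ (Fin m) → ℝ := D.indicator fun t => u t - g t
  have hum : AEStronglyMeasurable u (volume.restrict D) :=
    hu.continuousOn.aestronglyMeasurable hD.measurableSet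
  have hui : IntegrableOn u D :=
    have : IsFiniteMeasure (volume.restrict D) := ⟨by simpa using hvol⟩
    Integrable.of_bound hum B ((ae_restrict_iff' hD.measurableSet).2 (Eventually.of_forall hB))
  have hgi : Integrable g := hg.continuous.integrable_of_hasCompactSupport hgc
  have hf : Integrable f := (integrable_indicator_iff hD.measurableSet).2
    (hui.sub hgi.integrableOn)
  have hnear : ∀ t, dist t x₀ < ε / 4 → f t = 0 := fun t ht => by
    have h1 : χ t = 1 := χ.one_of_mem_closedBall (by simpa [χ] using ht.le)
    simp [f, g, h1]
  obtain ⟨R, hR⟩ := hb.subset_closedBall x₀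
  have hfar : ∀ t, R < dist t x₀ → f t = 0 := fun t ht =>
    indicator_of_notMem (fun h => not_le.2 ht (hR h)) _
  obtain ⟨hw, hw0⟩ := harmonic_potential_of_eq_zero_near hm hf (by positivity) hnear hfar
  refine ⟨g, _, hg, hgc, ?_, hw, hw0, ?_⟩
  · have h1 : χ x₀ = 1 :=
      χ.one_of_mem_closedBall (Metric.mem_closedBall_self χ.rIn_pos.le)
    simp [g, h1]
  · ext x
    have hgE : Integrable fun t => g t * laplaceFundamentalSolution (x - t) :=
      hgc.convolutionExists_left (lsmul ℝ ℝ) hg.continuous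
        (locallyIntegrable_laplaceFundamentalSolution hm) x
    have huE := integrableOn_laplaceFundamentalSolution_sub_mul hm hD.measurableSet hvol hum hB x
    have e1 : convPotential g x = ∫ t in D, g t * laplaceFundamentalSolution (x - t) :=
      (setIntegral_eq_integral_of_forall_compl_eq_zero fun t ht => by simp [hgD t ht]).symm
    have e2 : ∫ t, f t * laplaceFundamentalSolution (x - t) =
        ∫ t in D, (laplaceFundamentalSolution (x - t) * u t -
          g t * laplaceFundamentalSolution (x - t)) := by
      rw [← setIntegral_eq_integral_of_forall_compl_eq_zero (s := D)
        fun t ht => by simp [f, indicator_of_notMem ht]]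
      refine setIntegral_congr_fun hD.measurableSet fun t ht => ?_
      simp only [f, indicator_of_mem ht]
      ring
    rw [Pi.add_apply, e1, e2, integral_sub huE hgE.integrableOn, add_sub_cancel]
    rfl

/-- The restriction `n ≤ 1` matches the `C²` regularity recorded for the harmonic remainder. -/
theorem contDiffOn_newtonianPotential (hm : 3 ≤ m) (hD : IsOpen D)
    (hb : Bornology.IsBounded D) {B : ℝ} (hB : ∀ y ∈ D, |u y| ≤ B) {n : ℕ} (hn : n ≤ 1)
    (hu : ContDiffOn ℝ n u D) : ContDiffOn ℝ (n + 1) (newtonianPotential D u) D := by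
  intro x hx
  obtain ⟨g, w, hg, hgc, -, hw, -, he⟩ :=
    exists_newtonianPotential_eq_convPotential_add hm hD hb hB hu hx
  rw [he]
  refine ((contDiff_convPotential hm hg hgc).contDiffAt.add (hw.of_le ?_)).contDiffWithinAt
  have : ((n + 1 : ℕ) : WithTop ℕ∞) ≤ ((2 : ℕ) : WithTop ℕ∞) := by exact_mod_cast (by omega)
  exact_mod_cast this

/-- Poisson's equation in the interior of the domain. -/
theorem laplacian_newtonianPotential (hm : 3 ≤ m) (hD : IsOpen D)
    (hb : Bornology.IsBounded D) {B : ℝ} (hB : ∀ y ∈ D, |u y| ≤ B)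
    (hu : ContDiffOn ℝ 1 u D) {x : EuclideanSpace ℝ (Fin m)} (hx : x ∈ D) :
    Δ (newtonianPotential D u) x = u x := by
  obtain ⟨g, w, hg, hgc, hgx, hw, hw0, he⟩ :=
    exists_newtonianPotential_eq_convPotential_add hm hD hb hB (n := 1) (by exact_mod_cast hu) hx
  have hg2 : ContDiff ℝ 2 (convPotential g) := by
    have := contDiff_convPotential hm hg hgc
    norm_num at this
    exact this
  rw [he, hg2.contDiffAt.laplacian_add hw, hw0, add_zero,
    laplacian_convPotential hm (by exact_mod_cast hg) hgc, hgx]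

end Interior

end

/-! ### Assembly: Hölder regularity and the interior bootstrap. -/

theorem theorem5p4 {m : ℕ} (hm : 3 ≤ m) (D : Set (EuclideanSpace ℝ (Fin m)))
    (hD : IsBoundedLipschitzDomain D) (μ : ℝ) (hμ : μ ≠ 0)
    (α : ℝ≥0) (hα₀ : 0 < α) (hα₁ : α < 1)
    (h : EuclideanSpace ℝ (Fin m) → ℝ) (h_holder : IsHolderOn α h (closure D))
    (h_harmonic : InnerProductSpace.HarmonicOnNhd h D) :
    ∃ u : EuclideanSpace ℝ (Fin m) → ℝ,
      IsL2Solution D (μ ^ 2) h u ∧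
      (∀ v : EuclideanSpace ℝ (Fin m) → ℝ,
        IsL2Solution D (μ ^ 2) h v → v =ᵐ[volume.restrict D] u) ∧
      IsHolderOn α u (closure D) ∧
      IsPanharmonicOn μ u D ∧
      (∀ x ∈ D,
        IntegrableOn (fun y => laplaceFundamentalSolution (x - y) * u y) D ∧
        u x - μ ^ 2 * newtonianPotential D u x = h x) := by
  obtain ⟨hDo, -, hDb, -⟩ := hD
  have hvol : volume D < ⊤ := hDb.measure_lt_top
  have : IsFiniteMeasure (volume.restrict D) := ⟨by simpa using hvol⟩
  obtain ⟨C, hC⟩ := h_holder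
  obtain ⟨u₀, hu₀, heq₀⟩ :=
    exists_continuous_solution hm hDo hDb (sq_nonneg μ) (hC.continuousOn hα₀)
  obtain ⟨B₀, hB₀⟩ := hDb.isCompact_closure.exists_bound_of_continuousOn hu₀
  have hB₀' : ∀ y ∈ D, |u₀ y| ≤ B₀.toNNReal := fun y hy =>
    (hB₀ y (subset_closure hy)).trans (Real.le_coe_toNNReal _)
  have hmeas₀ : AEStronglyMeasurable u₀ (volume.restrict D) :=
    (hu₀.mono subset_closure).aestronglyMeasurable hDo.measurableSet
  obtain ⟨L, hL⟩ := exists_newtonianPotential_bound hm hDo.measurableSet hvol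
  -- Redefining the solution off `closure D` makes the integral equation an identity of functions on
  -- the whole space, so that regularity and Laplacians can be read off from it.
  set u : EuclideanSpace ℝ (Fin m) → ℝ := fun x => h x + μ ^ 2 * newtonianPotential D u₀ x
  have huu₀ : ∀ x ∈ closure D, u x = u₀ x := fun x hx => by
    have := heq₀ x hx
    simp only [u]; linarith
  have hTu : newtonianPotential D u = newtonianPotential D u₀ := by
    ext x
    exact newtonianPotential_congr_ae ((ae_restrict_iff' hDo.measurableSet).2
      (Filter.Eventually.of_forall fun y hy => huu₀ y (subset_closure hy))) x
  have huc : ContinuousOn u D :=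
    (hu₀.mono subset_closure).congr fun x hx => huu₀ x (subset_closure hx)
  have hB : ∀ y ∈ D, |u y| ≤ B₀.toNNReal := fun y hy => by
    rw [huu₀ y (subset_closure hy)]; exact hB₀' y hy
  have hmeas : AEStronglyMeasurable u (volume.restrict D) :=
    huc.aestronglyMeasurable hDo.measurableSet
  have heq : ∀ x, u x - μ ^ 2 * newtonianPotential D u x = h x := fun x => by
    rw [hTu]; simp [u]
  have hsol : IsL2Solution D (μ ^ 2) h u :=
    ⟨MemLp.of_bound hmeas B₀.toNNReal ((ae_restrict_iff' hDo.measurableSet).2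
      (Filter.Eventually.of_forall hB)), Filter.Eventually.of_forall heq⟩
  have hu_eq : u = h + fun x => μ ^ 2 • newtonianPotential D u x := by
    ext x
    have := heq x
    simp only [Pi.add_apply, smul_eq_mul]; linarith
  -- Bootstrap: `u` is `C⁰`, so `T u` is `C¹`, so `u = h + μ² T u` is `C¹`, so `T u` is `C²`.
  have hT1 := contDiffOn_newtonianPotential hm hDo hDb hB (n := 0) (by norm_num)
    (by exact_mod_cast contDiffOn_zero.2 huc)
  have hu1 : ContDiffOn ℝ 1 u D := by
    rw [hu_eq]
    refine (h_harmonic.contDiffOn.of_le (by norm_num)).add (ContDiffOn.const_smul (μ ^ 2) ?_)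
    simpa using hT1
  have hT2 : ContDiffOn ℝ 2 (newtonianPotential D u) D := by
    have := contDiffOn_newtonianPotential hm hDo hDb hB (n := 1) le_rfl (by exact_mod_cast hu1)
    convert this using 1
    norm_num
  refine ⟨u, hsol, fun v hv => hsol.ae_eq hm hvol (sq_nonneg μ) hv, ?_, ⟨?_, fun x hx => ?_⟩,
    fun x _ => ⟨integrableOn_laplaceFundamentalSolution_sub_mul hm hDo.measurableSet hvol hmeas hB x,
      heq x⟩⟩
  · have hlip := (hL u₀ B₀.toNNReal hmeas₀ hB₀').1
    -- On a set of bounded diameter, Lipschitz functions are Hölder of every smaller exponent.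
    obtain ⟨R, hR⟩ := Metric.isBounded_iff_nndist.1 hDb.closure
    have hT := (holderOnWith_one.2 (hlip.lipschitzOnWith (s := closure D))).of_le
      (fun x hx y hy => by rw [edist_nndist]; exact_mod_cast hR hx hy) hα₁.le
    exact ⟨_, HolderWith.restrict_iff.1 (hC.holderWith.add (hT.holderWith.smul (μ ^ 2)))⟩
  · rw [hu_eq]
    exact h_harmonic.contDiffOn.add (hT2.const_smul (μ ^ 2))
  · have hTx : ContDiffAt ℝ 2 (newtonianPotential D u) x := hT2.contDiffAt (hDo.mem_nhds hx)
    have hlap : Δ u x = Δ (h + μ ^ 2 • newtonianPotential D u) x :=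
      congrArg (fun f => (Δ f : EuclideanSpace ℝ (Fin m) → ℝ) x) hu_eq
    rw [hlap, (h_harmonic x hx).1.laplacian_add
      (show ContDiffAt ℝ 2 (μ ^ 2 • newtonianPotential D u) x from hTx.const_smul (μ ^ 2)),
      InnerProductSpace.laplacian_smul _ hTx, (h_harmonic x hx).2.eq_of_nhds,
      laplacian_newtonianPotential hm hDo hDb hB hu1 hx]
    simp
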